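/- \textbf{Theorem (Dutch Book Theorem for short games).} Games are combinatorial games $G=\{G^L\mid G^R\}$ in Conway's sense, with the usual sum, negative and order: $G>0$ ($G<0$) means that Left (Right) wins $G$ whoever moves first, $G\ge 0$ means that Left wins when Right moves first, and $G\ge H$ means $G-H\ge 0$. A game is \emph{short} if it has only finitely many positions. For $n\in\mathbb N=\{0,1,2,\dots\}$, $n\cdot G$ is the $n$-fold sum $G+\cdots+G$. Real numbers are identified with games in the usual way (a real number $r$ is $\{\text{dyadic fractions}<r\mid\text{dyadic fractions}>r\}$). The \emph{mean value} of a short game $G$ is the real number $\mu(G)$ for which there is a natural number $m$ with $n\mu(G)-m\le n\cdot G\le n\mu(G)+m$ for all natural numbers $n$. Let $A$ and $B$ be finite sets and let $G(a,b)$, $a\in A$, $b\in B$, be short games. Suppose that $G$ is \emph{coherent}: there are no natural numbers $n_b$ $(b\in B)$ such that $\sum_{b\in B}n_b\cdot G(a,b)<0$ for all $a\in A$. Then at least one of the following holds. \begin{enumerate} \item There are a rational probability vector $(p_a)_{a\in A}$ and an integer $n\ge 1$ with $np_a\in\mathbb N$ for all $a$ such that $\sum_{a\in A}(np_a)\cdot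 G(a,b)>0$ for all $b\in B$. \item There are natural numbers $(n_b)_{b\in B}$, not all zero, a rational probability vector $(p_a)_{a\in A}$ and an integer $n\ge 1$ with $np_a\in\mathbb N$ for all $a$ such that \begin{itemize} \item for all $a\in A$, $\mu\bigl(\sum_{b\in B}n_b\cdot G(a,b)\bigr)$ exists and is $\le 0$, with equality whenever $p_a>0$; \item for all $b\in B$, $\mu\bigl(\sum_{a\in A}(np_a)\cdot G(a,b)\bigr)$ exists and is $\ge 0$, with equality whenever $n_b>0$. \end{itemize} \end{enumerate} -/

import Mathlib

universe u v w

namespace Comb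

/-- A combinatorial game `{G^L | G^R}`: two families of previously constructed games,
the positions Left may move to and the positions Right may move to. -/
inductive PGame : Type (u + 1)
  | mk : (l r : Type u) → (l → PGame) → (r → PGame) → PGame

namespace PGame

/-- Index type of the left options. -/
def LeftMoves : PGame.{u} → Type u
  | mk l _ _ _ => l

/-- Index type of the right options. -/
def RightMoves : PGame.{u} → Type u
  | mk _ r _ _ => r

/-- The left options. -/
def moveLeft : (g : PGame.{u}) → LeftMoves g → PGame.{u}
  | mk _ _ L _ => L

/-- The right options. -/
def moveRight : (g : PGame.{u}) → RightMoves g → PGame.{u}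
  | mk _ _ _ R => R

/-- `IsOption x y`: `x` is a left or a right option of `y`. -/
inductive IsOption : PGame.{u} → PGame.{u} → Prop
  | moveLeft {x : PGame.{u}} (i : x.LeftMoves) : IsOption (x.moveLeft i) x
  | moveRight {x : PGame.{u}} (j : x.RightMoves) : IsOption (x.moveRight j) x

theorem wf_isOption : WellFounded IsOption.{u} :=
  ⟨fun x => by
    induction x with
    | mk l r L R ihL ihR =>
      refine ⟨_, fun y h => ?_⟩
      generalize hz : mk l r L R = z at h
      cases h with
      | moveLeft i => subst hz; exact ihL i
      | moveRight j => subst hz; exact ihR j⟩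

/-- A game is short if it has only finitely many positions (the game itself and all games
reachable from it by finitely many moves of either player). -/
def Short (g : PGame.{u}) : Prop :=
  {x : PGame.{u} | Relation.ReflTransGen IsOption x g}.Finite

/-- `(leftWins g).1`: Left wins `g` when Left moves first.
`(leftWins g).2`: Left wins `g` when Right moves first.
A player who has to move and has no option loses. -/
def leftWins : PGame.{u} → Prop × Prop
  | mk _ _ L R => (∃ i, (leftWins (L i)).2, ∀ j, (leftWins (R j)).1)

/-- Conway's order: `x ≤ y` iff no left option of `x` is `≥ y` and no right option of `y`
is `≤ x`. -/
instance : LE PGame.{u} :=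
  ⟨Sym2.GameAdd.recursion wf_isOption fun x y le =>
    (∀ i : x.LeftMoves, ¬ le y (x.moveLeft i) (Sym2.GameAdd.snd_fst <| IsOption.moveLeft i)) ∧
    ∀ j : y.RightMoves, ¬ le (y.moveRight j) x (Sym2.GameAdd.fst_snd <| IsOption.moveRight j)⟩

theorem le_iff {x y : PGame.{u}} :
    x ≤ y ↔ (∀ i, ¬ y ≤ x.moveLeft i) ∧ ∀ j, ¬ y.moveRight j ≤ x := by
  unfold LE.le instLE
  simp only
  rw [Sym2.GameAdd.recursion_eq]

theorem not_le_moveLeft_of_le {x y : PGame.{u}} (h : x ≤ y) (i : x.LeftMoves) :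
    ¬ y ≤ x.moveLeft i := (le_iff.1 h).1 i

theorem not_moveRight_le_of_le {x y : PGame.{u}} (h : x ≤ y) (j : y.RightMoves) :
    ¬ y.moveRight j ≤ x := (le_iff.1 h).2 j

protected theorem le_refl (x : PGame.{u}) : x ≤ x := by
  induction x with
  | mk l r L R ihL ihR =>
    exact le_iff.2 ⟨fun i h => not_le_moveLeft_of_le h i (ihL i),
      fun j h => not_moveRight_le_of_le h j (ihR j)⟩

theorem le_trans_aux {x y z : PGame.{u}}
    (h₁ : ∀ i, y ≤ z → z ≤ x.moveLeft i → y ≤ x.moveLeft i)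
    (h₂ : ∀ j, z.moveRight j ≤ x → x ≤ y → z.moveRight j ≤ y)
    (hxy : x ≤ y) (hyz : y ≤ z) : x ≤ z :=
  le_iff.2 ⟨fun i h => not_le_moveLeft_of_le hxy i (h₁ i hyz h),
    fun j h => not_moveRight_le_of_le hyz j (h₂ j h hxy)⟩

theorem le_trans_all (x y z : PGame.{u}) :
    (x ≤ y → y ≤ z → x ≤ z) ∧ (y ≤ z → z ≤ x → y ≤ x) ∧ (z ≤ x → x ≤ y → z ≤ y) := by
  induction x generalizing y z with
  | mk xl xr xL xR ihxl ihxr =>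
  induction y generalizing z with
  | mk yl yr yL yR ihyl ihyr =>
  induction z with
  | mk zl zr zL zR ihzl ihzr =>
  exact
    ⟨le_trans_aux (fun i => (ihxl i _ _).2.1) fun j => (ihzr j).2.2,
      le_trans_aux (fun i => (ihyl i _).2.2) fun j => (ihxr j _ _).1,
      le_trans_aux (fun i => (ihzl i).1) fun j => (ihyr j _).2.1⟩

instance : Preorder PGame.{u} where
  le_refl := PGame.le_refl
  le_trans x y z := (le_trans_all x y z).1

theorem not_le_of_le_moveLeft {x y : PGame.{u}} (i : y.LeftMoves) (h : x ≤ y.moveLeft i) :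
    ¬ y ≤ x := fun h' => not_le_moveLeft_of_le h' i h

theorem not_le_of_moveRight_le {x y : PGame.{u}} (j : x.RightMoves) (h : x.moveRight j ≤ y) :
    ¬ y ≤ x := fun h' => not_moveRight_le_of_le h' j h

theorem le_of_options {x y : PGame.{u}} (hl : ∀ i, ∃ j, x.moveLeft i ≤ y.moveLeft j)
    (hr : ∀ j, ∃ i, x.moveRight i ≤ y.moveRight j) : x ≤ y :=
  le_iff.2 ⟨fun i => (hl i).elim fun j h => not_le_of_le_moveLeft j h,
    fun j => (hr j).elim fun i h => not_le_of_moveRight_le i h⟩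

/-- The game `0 = {∅ | ∅}`. -/
instance : Zero PGame.{u} := ⟨mk PEmpty PEmpty PEmpty.elim PEmpty.elim⟩

/-- The game `1 = {0 | ∅}`. -/
instance : One PGame.{u} := ⟨mk PUnit PEmpty (fun _ => 0) PEmpty.elim⟩

/-- The negative of a game: the roles of Left and Right are exchanged. -/
def neg : PGame.{u} → PGame.{u}
  | mk l r L R => mk r l (fun j => neg (R j)) (fun i => neg (L i))

instance : Neg PGame.{u} := ⟨neg⟩

theorem neg_mk {l r : Type u} (L : l → PGame.{u}) (R : r → PGame.{u}) :
    -mk l r L R = mk r l (fun j => -R j) (fun i => -L i) := rfl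

/-- The sum of two games: a move is a move in exactly one of the two summands. -/
noncomputable def add (x : PGame.{u}) : PGame.{u} → PGame.{u} :=
  PGame.rec (motive := fun _ => PGame.{u} → PGame.{u})
    (fun xl xr _ _ ihxl ihxr y =>
      PGame.rec (motive := fun _ => PGame.{u})
        (fun yl yr yL yR ihyl ihyr =>
          mk (xl ⊕ yl) (xr ⊕ yr)
            (Sum.elim (fun i => ihxl i (mk yl yr yL yR)) ihyl)
            (Sum.elim (fun j => ihxr j (mk yl yr yL yR)) ihyr)) y) x

noncomputable instance : Add PGame.{u} := ⟨add⟩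

theorem mk_add_mk {xl xr yl yr : Type u} (xL : xl → PGame.{u}) (xR : xr → PGame.{u})
    (yL : yl → PGame.{u}) (yR : yr → PGame.{u}) :
    mk xl xr xL xR + mk yl yr yL yR =
      mk (xl ⊕ yl) (xr ⊕ yr)
        (Sum.elim (fun i => xL i + mk yl yr yL yR) (fun i => mk xl xr xL xR + yL i))
        (Sum.elim (fun j => xR j + mk yl yr yL yR) (fun j => mk xl xr xL xR + yR j)) := rfl

theorem add_comm_le (x y : PGame.{u}) : x + y ≤ y + x := by
  induction x generalizing y with
  | mk xl xr xL xR ihxl ihxr =>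
  induction y with
  | mk yl yr yL yR ihyl ihyr =>
  exact le_of_options
    (Sum.rec (fun i => ⟨Sum.inr i, ihxl i _⟩) (fun i => ⟨Sum.inl i, ihyl i⟩))
    (Sum.rec (fun j => ⟨Sum.inr j, ihyr j⟩) (fun j => ⟨Sum.inl j, ihxr j _⟩))

theorem add_zero_le (x : PGame.{u}) : x + 0 ≤ x := by
  induction x with
  | mk xl xr xL xR ihl ihr =>
  exact le_of_options (Sum.rec (fun i => ⟨i, ihl i⟩) (fun i => i.elim))
    (fun j => ⟨Sum.inl j, ihr j⟩)

theorem le_add_zero (x : PGame.{u}) : x ≤ x + 0 := by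
  induction x with
  | mk xl xr xL xR ihl ihr =>
  exact le_of_options (fun i => ⟨Sum.inl i, ihl i⟩)
    (Sum.rec (fun j => ⟨j, ihr j⟩) (fun j => j.elim))

theorem add_assoc_le (x y z : PGame.{u}) : x + y + z ≤ x + (y + z) := by
  induction x generalizing y z with
  | mk xl xr xL xR ihxl ihxr =>
  induction y generalizing z with
  | mk yl yr yL yR ihyl ihyr =>
  induction z with
  | mk zl zr zL zR ihzl ihzr =>
  exact le_of_options
    (Sum.rec (Sum.rec (fun i => ⟨Sum.inl i, ihxl i _ _⟩)
        (fun i => ⟨Sum.inr (Sum.inl i), ihyl i _⟩))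
      (fun i => ⟨Sum.inr (Sum.inr i), ihzl i⟩))
    (Sum.rec (fun j => ⟨Sum.inl (Sum.inl j), ihxr j _ _⟩)
      (Sum.rec (fun j => ⟨Sum.inl (Sum.inr j), ihyr j _⟩)
        (fun j => ⟨Sum.inr j, ihzr j⟩)))

theorem le_add_assoc (x y z : PGame.{u}) : x + (y + z) ≤ x + y + z := by
  induction x generalizing y z with
  | mk xl xr xL xR ihxl ihxr =>
  induction y generalizing z with
  | mk yl yr yL yR ihyl ihyr =>
  induction z with
  | mk zl zr zL zR ihzl ihzr =>
  exact le_of_options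
    (Sum.rec (fun i => ⟨Sum.inl (Sum.inl i), ihxl i (mk yl yr yL yR) (mk zl zr zL zR)⟩)
      (Sum.rec (fun i => ⟨Sum.inl (Sum.inr i), ihyl i _⟩)
        (fun i => ⟨Sum.inr i, ihzl i⟩)))
    (Sum.rec (Sum.rec (fun j => ⟨Sum.inl j, ihxr j (mk yl yr yL yR) (mk zl zr zL zR)⟩)
        (fun j => ⟨Sum.inr (Sum.inl j), ihyr j _⟩))
      (fun j => ⟨Sum.inr (Sum.inr j), ihzr j⟩))

theorem add_le_add_right_aux (x y z : PGame.{u}) :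
    (x ≤ y → x + z ≤ y + z) ∧ (¬ y ≤ x → ¬ y + z ≤ x + z) := by
  induction x generalizing y z with
  | mk xl xr xL xR ihxl ihxr =>
  induction y generalizing z with
  | mk yl yr yL yR ihyl ihyr =>
  induction z with
  | mk zl zr zL zR ihzl ihzr =>
  constructor
  · intro h
    refine le_iff.2 ⟨Sum.rec (fun i => ?_) (fun i => ?_), Sum.rec (fun j => ?_) (fun j => ?_)⟩
    · exact (ihxl i _ _).2 (not_le_moveLeft_of_le h i)
    · exact not_le_of_le_moveLeft (y := mk yl yr yL yR + mk zl zr zL zR) (Sum.inr i)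
        ((ihzl i).1 h)
    · exact (ihyr j _).2 (not_moveRight_le_of_le h j)
    · exact not_le_of_moveRight_le (x := mk xl xr xL xR + mk zl zr zL zR) (Sum.inr j)
        ((ihzr j).1 h)
  · intro h
    rw [le_iff] at h
    push Not at h
    by_cases h' : ∃ i, mk xl xr xL xR ≤ (mk yl yr yL yR).moveLeft i
    · obtain ⟨i, hi⟩ := h'
      exact not_le_of_le_moveLeft (y := mk yl yr yL yR + mk zl zr zL zR) (Sum.inl i)
        ((ihyl i _).1 hi)
    · push Not at h'
      obtain ⟨j, hj⟩ := h h'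
      exact not_le_of_moveRight_le (x := mk xl xr xL xR + mk zl zr zL zR) (Sum.inl j)
        ((ihxr j _ _).1 hj)

theorem add_le_add_right' {x y : PGame.{u}} (h : x ≤ y) (z : PGame.{u}) : x + z ≤ y + z :=
  (add_le_add_right_aux x y z).1 h

theorem add_le_add_left' {x y : PGame.{u}} (h : x ≤ y) (z : PGame.{u}) : z + x ≤ z + y :=
  (add_comm_le z x).trans ((add_le_add_right' h z).trans (add_comm_le y z))

theorem neg_le_neg_iff' (x y : PGame.{u}) : -x ≤ -y ↔ y ≤ x := by
  suffices h : (-x ≤ -y ↔ y ≤ x) ∧ (-y ≤ -x ↔ x ≤ y) from h.1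
  induction x generalizing y with
  | mk xl xr xL xR ihxl ihxr =>
  induction y with
  | mk yl yr yL yR ihyl ihyr =>
  constructor
  · rw [le_iff, le_iff (x := mk yl yr yL yR), and_comm]
    exact and_congr (forall_congr' fun i => not_congr (ihyl i).2)
      (forall_congr' fun j => not_congr (ihxr j _).2)
  · rw [le_iff, le_iff (x := mk xl xr xL xR), and_comm]
    exact and_congr (forall_congr' fun i => not_congr (ihxl i _).1)
      (forall_congr' fun j => not_congr (ihyr j).1)

theorem not_le_of_add_moveRight_le {x y z : PGame.{u}} (j : y.RightMoves)
    (h : x + y.moveRight j ≤ z) : ¬ z ≤ x + y := by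
  cases x; cases y
  exact not_le_of_moveRight_le (Sum.inr j) h

theorem not_le_of_moveRight_add_le {x y z : PGame.{u}} (j : x.RightMoves)
    (h : x.moveRight j + y ≤ z) : ¬ z ≤ x + y := by
  cases x; cases y
  exact not_le_of_moveRight_le (Sum.inl j) h

theorem neg_add_le (x : PGame.{u}) : -x + x ≤ 0 := by
  induction x with
  | mk xl xr xL xR ihl ihr =>
  refine le_iff.2 ⟨Sum.rec (fun j => ?_) (fun i => ?_), fun j => j.elim⟩
  · exact not_le_of_add_moveRight_le (x := -xR j) (y := mk xl xr xL xR) j (ihr j)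
  · exact not_le_of_moveRight_add_le (x := -mk xl xr xL xR) (y := xL i) i (ihl i)

theorem neg_zero_eq : -(0 : PGame.{u}) = 0 := by
  change mk _ _ _ _ = mk _ _ _ _
  congr 1 <;> exact funext fun i => i.elim

theorem neg_neg_eq (x : PGame.{u}) : - -x = x := by
  induction x with
  | mk xl xr xL xR ihl ihr => simp only [neg_mk, ihl, ihr]

theorem neg_add_eq (x y : PGame.{u}) : -(x + y) = -x + -y := by
  induction x generalizing y with
  | mk xl xr xL xR ihxl ihxr =>
  induction y with
  | mk yl yr yL yR ihyl ihyr =>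
  rw [mk_add_mk, neg_mk, neg_mk, neg_mk, mk_add_mk]
  congr 1 <;> funext i <;> rcases i with i | i
  · exact ihxr i _
  · exact ihyr i
  · exact ihxl i _
  · exact ihyl i

theorem le_neg_add (x : PGame.{u}) : 0 ≤ -x + x := by
  rw [← neg_le_neg_iff', neg_zero_eq, neg_add_eq]
  exact neg_add_le (-x)

/-- `0 ≤ x` holds iff Left wins `x` when Right moves first, and `x ≤ 0` fails iff Left wins
`x` when Left moves first. -/
theorem leftWins_iff (x : PGame.{u}) :
    ((leftWins x).1 ↔ ¬ x ≤ 0) ∧ ((leftWins x).2 ↔ 0 ≤ x) := by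
  induction x with
  | mk xl xr xL xR ihl ihr =>
  constructor
  · rw [le_iff]
    simp only [leftWins, not_and_or, not_forall, not_not]
    constructor
    · rintro ⟨i, hi⟩
      exact Or.inl ⟨i, (ihl i).2.1 hi⟩
    · rintro (⟨i, hi⟩ | ⟨j, -⟩)
      · exact ⟨i, (ihl i).2.2 hi⟩
      · exact j.elim
  · rw [le_iff]
    exact ⟨fun h => ⟨fun i => i.elim, fun j => (ihr j).1.1 (h j)⟩,
      fun h j => (ihr j).1.2 (h.2 j)⟩

/-- A game is negative iff Right wins whoever moves first. -/
theorem lt_zero_iff (x : PGame.{u}) : x < 0 ↔ ¬ (leftWins x).1 ∧ ¬ (leftWins x).2 := by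
  rw [(leftWins_iff x).1, (leftWins_iff x).2, not_not, lt_iff_le_not_ge]

/-- A game is positive iff Left wins whoever moves first. -/
theorem zero_lt_iff (x : PGame.{u}) : 0 < x ↔ (leftWins x).1 ∧ (leftWins x).2 := by
  rw [(leftWins_iff x).1, (leftWins_iff x).2, lt_iff_le_not_ge, and_comm]

end PGame

/-- Games up to equality: `G = H` means `G ≤ H` and `H ≤ G`. -/
def Game : Type (u + 1) := Antisymmetrization PGame.{u} (· ≤ ·)

namespace Game

noncomputable instance : PartialOrder Game.{u} :=
  inferInstanceAs (PartialOrder (Antisymmetrization PGame.{u} (· ≤ ·)))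

/-- The value of a game, i.e. its class with respect to equality of games. -/
def of (x : PGame.{u}) : Game.{u} := toAntisymmetrization (· ≤ ·) x

theorem of_le_of {x y : PGame.{u}} : of x ≤ of y ↔ x ≤ y := Iff.rfl

theorem of_lt_of {x y : PGame.{u}} : of x < of y ↔ x < y := Iff.rfl

theorem of_eq {x y : PGame.{u}} (h₁ : x ≤ y) (h₂ : y ≤ x) : of x = of y :=
  Quotient.sound ⟨h₁, h₂⟩

theorem of_surjective : Function.Surjective of.{u} := Quotient.mk_surjective

instance : Zero Game.{u} := ⟨of 0⟩

instance : One Game.{u} := ⟨of 1⟩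

noncomputable instance : Add Game.{u} :=
  ⟨Quotient.map₂ (· + ·) fun _ _ h₁ _ _ h₂ =>
    ⟨(PGame.add_le_add_right' h₁.1 _).trans (PGame.add_le_add_left' h₂.1 _),
      (PGame.add_le_add_right' h₁.2 _).trans (PGame.add_le_add_left' h₂.2 _)⟩⟩

instance : Neg Game.{u} :=
  ⟨Quotient.map (- ·) fun _ _ h =>
    ⟨(PGame.neg_le_neg_iff' _ _).2 h.2, (PGame.neg_le_neg_iff' _ _).2 h.1⟩⟩

theorem of_zero : of (0 : PGame.{u}) = 0 := rfl

theorem of_one : of (1 : PGame.{u}) = 1 := rfl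

theorem of_add (x y : PGame.{u}) : of (x + y) = of x + of y := rfl

theorem of_neg (x : PGame.{u}) : of (-x) = -of x := rfl

theorem add_comm' (a b : Game.{u}) : a + b = b + a := by
  obtain ⟨x, rfl⟩ := of_surjective a
  obtain ⟨y, rfl⟩ := of_surjective b
  exact of_eq (PGame.add_comm_le x y) (PGame.add_comm_le y x)

theorem add_zero' (a : Game.{u}) : a + 0 = a := by
  obtain ⟨x, rfl⟩ := of_surjective a
  exact of_eq (PGame.add_zero_le x) (PGame.le_add_zero x)

/-- The Abelian group of games; `n • G` is the `n`-fold sum `G + ⋯ + G`. -/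
noncomputable instance : AddCommGroup Game.{u} where
  add_assoc a b c := by
    obtain ⟨x, rfl⟩ := of_surjective a
    obtain ⟨y, rfl⟩ := of_surjective b
    obtain ⟨z, rfl⟩ := of_surjective c
    exact of_eq (PGame.add_assoc_le x y z) (PGame.le_add_assoc x y z)
  zero_add a := by rw [add_comm', add_zero']
  add_zero := add_zero'
  nsmul := nsmulRec
  zsmul := zsmulRec
  neg_add_cancel a := by
    obtain ⟨x, rfl⟩ := of_surjective a
    exact of_eq (PGame.neg_add_le x) (PGame.le_neg_add x)
  add_comm := add_comm'

instance : IsOrderedAddMonoid Game.{u} where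
  add_le_add_left a b h c := by
    obtain ⟨x, rfl⟩ := of_surjective a
    obtain ⟨y, rfl⟩ := of_surjective b
    obtain ⟨z, rfl⟩ := of_surjective c
    exact PGame.add_le_add_right' (of_le_of.1 h) z

end Game

namespace PGame

/-- The `n`-fold sum `G + ⋯ + G`. -/
noncomputable def natMul : ℕ → PGame.{u} → PGame.{u}
  | 0, _ => 0
  | n + 1, x => natMul n x + x

/-- Integer multiples of a game: for `n < 0`, `n · G` is `(-n) · (-G)`. -/
noncomputable def intMul : ℤ → PGame.{u} → PGame.{u}
  | Int.ofNat n, x => natMul n x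
  | Int.negSucc n, x => natMul (n + 1) (-x)

/-- The game `2⁻ᵐ`, given by `2⁻⁰ = 1` and `2⁻⁽ᵐ⁺¹⁾ = {0 | 2⁻ᵐ}`. -/
def powHalf : ℕ → PGame.{u}
  | 0 => 1
  | m + 1 => mk PUnit PUnit (fun _ => 0) (fun _ => powHalf m)

/-- The game identified with the dyadic fraction `k / 2 ^ m`. -/
noncomputable def dyadic (q : ℤ × ℕ) : PGame.{u} := intMul q.1 (powHalf q.2)

/-- The game identified with the real number `r`: its left (right) options are the dyadic
fractions smaller (larger) than `r`. (If `r` is itself dyadic this game is equal to `dyadic`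
of `r`.) -/
noncomputable def ofReal (r : ℝ) : PGame.{u} :=
  mk (ULift.{u} {q : ℤ × ℕ // (q.1 : ℝ) / 2 ^ q.2 < r})
    (ULift.{u} {q : ℤ × ℕ // r < (q.1 : ℝ) / 2 ^ q.2})
    (fun q => dyadic q.down.1) (fun q => dyadic q.down.1)

end PGame

namespace Game

/-- The value of the game identified with the real number `r`. -/
noncomputable def ofReal (r : ℝ) : Game.{u} := of (PGame.ofReal r)

/-- `HasMeanValue G μ`: the real number `μ` is the mean value of `G`, i.e. there is a natural
number `m` with `n μ - m ≤ n · G ≤ n μ + m` for all natural numbers `n`. -/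
def HasMeanValue (G : Game.{u}) (μ : ℝ) : Prop :=
  ∃ m : ℕ, ∀ n : ℕ, ofReal (n * μ - m) ≤ n • G ∧ n • G ≤ ofReal (n * μ + m)

end Game

/-- The game played by Alice (as Left) when the outcome is `a` and the bookmakers combine
their games with multiplicities `k b`. -/
noncomputable def bookGame {A : Type v} {B : Type w} [Fintype B] (G : A → B → PGame.{u})
    (k : B → ℕ) (a : A) : Game.{u} :=
  ∑ b, k b • Game.of (G a b)

/-- The game played by Alice (as Left) against bookmaker `b` when the outcomes `a` are
combined with multiplicities `c a`. -/
noncomputable def aliceGame {A : Type v} {B : Type w} [Fintype A] (G : A → B → PGame.{u})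
    (c : A → ℕ) (b : B) : Game.{u} :=
  ∑ a, c a • Game.of (G a b)

/-- A Dutch book: multiplicities for the bookmakers such that Alice loses the combined game
(it is negative) for every outcome. -/
def IsDutchBook {A : Type v} {B : Type w} [Fintype B] (G : A → B → PGame.{u})
    (k : B → ℕ) : Prop :=
  ∀ a, bookGame G k a < 0

/-- A payoff function is coherent if there is no Dutch book. -/
def Coherent {A : Type v} {B : Type w} [Fintype B] (G : A → B → PGame.{u}) : Prop :=
  ¬ ∃ k : B → ℕ, IsDutchBook G k

/-- `p` is a probability vector, `n` is a positive integer, and the numbers `n * p a` are the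
natural numbers `c a`. -/
def IsRepeatedMix {A : Type v} [Fintype A] (p : A → ℚ) (n : ℕ) (c : A → ℕ) : Prop :=
  p ∈ stdSimplex ℚ A ∧ 0 < n ∧ ∀ a, (c a : ℚ) = n * p a

end Comb

/-!
Every short game has a rational mean value, and the claim then follows from linear programming
over `ℚ` for the matrix `M a b` of the mean values of the games `G a b`.

*Linear programming.* A book with negative mean value for every outcome becomes a Dutch book when
it is repeated often enough (`HasRatMean.exists_nsmul_neg`). So coherence and a theorem of the
alternative (`exists_neg_or_exists_nonneg`) give weights `c` on the outcomes, not all zero, for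
which all column sums `∑ a, c a * M a b` are nonnegative. The same theorem for the negative
transpose of `M` gives either weights making all column sums positive, which after repetition make
all the games positive, or weights `k ≠ 0` on the bookmakers making all row sums nonpositive. In
the second case `c` and `k` satisfy `complementary_slackness`. Rationality of `M` is what makes
integral weights possible.

*Rational mean values.* The thermograph of a game is computed from those of its options. It is
taken here for temperatures `≥ -1`, where the integers need no separate treatment: moving in an
integer is a move that costs one unit. The walls are piecewise linear with slopes `0` and `±1`, and
for a short game all breakpoints lie on a grid of mesh `2⁻ᵏ`, so that walls are encoded as integer
sequences (`Walls`). Each game needs at most one bisection of the grid of its options, since the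
difference of two scaffolds has slopes `0`, `-1`, `-2` (`Walls.exists_fits`). The thermostatic
strategy (`IsThermograph.left_wins_sum`) shows that Left, moving second in a sum, wins when the
right walls at temperature `t` add up to more than `t`. Applied, at a temperature where its mast has
begun, to `n` copies of a game together with an integer, it bounds `n · x` from below by `n` times
the position of the mast up to a constant; the upper bound follows by passing to `-x`. So the mast
stands at the mean value, which is rational (`PGame.Short.exists_hasRatMean`).
-/

namespace Comb

/-! ### Moves in sums of games -/

namespace PGame

theorem moveRight_add_cases {x y : PGame.{u}} (j : (x + y).RightMoves) :
    (∃ i, (x + y).moveRight j = x.moveRight i + y) ∨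
      ∃ i, (x + y).moveRight j = x + y.moveRight i := by
  cases x; cases y
  rcases j with i | i
  · exact Or.inl ⟨i, rfl⟩
  · exact Or.inr ⟨i, rfl⟩

theorem moveRight_listSum_cases (l : List PGame.{u}) (j : l.sum.RightMoves) :
    ∃ l₁ x l₂ i, l = l₁ ++ x :: l₂ ∧
      l.sum.moveRight j = (l₁ ++ moveRight x i :: l₂).sum := by
  induction l with
  | nil => exact j.elim
  | cons y l ih =>
    change ((y + l.sum).RightMoves) at j
    rcases moveRight_add_cases j with ⟨i, hi⟩ | ⟨i, hi⟩
    · exact ⟨[], y, l, i, rfl, hi⟩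
    · obtain ⟨l₁, x, l₂, k, rfl, hk⟩ := ih i
      exact ⟨y :: l₁, x, l₂, k, rfl, hi.trans (by rw [hk]; rfl)⟩

theorem of_listSum (l : List PGame.{u}) : Game.of l.sum = (l.map Game.of).sum := by
  induction l with
  | nil => rfl
  | cons y l ih =>
    change Game.of y + Game.of l.sum = _
    rw [ih]
    exact List.sum_cons.symm

/-- Right, moving first in a sum, moves in exactly one component; so Left wins the sum moving
second as soon as she wins after each such move. -/
theorem zero_le_sum_of_moveRight {α : Type*} (f : α → PGame.{u}) (s : Multiset α)
    (h : ∀ a s', s = a ::ₘ s' → ∀ j,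
      ¬ Game.of ((f a).moveRight j) + (s'.map fun b => Game.of (f b)).sum ≤ 0) :
    0 ≤ (s.map fun b => Game.of (f b)).sum := by
  induction s using Quotient.inductionOn with
  | h l =>
  have hl : ((↑l : Multiset α).map fun b => Game.of (f b)).sum = Game.of (l.map f).sum := by
    rw [of_listSum, Multiset.map_coe, Multiset.sum_coe, List.map_map]; rfl
  change 0 ≤ ((↑l : Multiset α).map fun b => Game.of (f b)).sum
  rw [hl]
  refine le_iff.2 ⟨fun i => i.elim, fun j hj => ?_⟩
  obtain ⟨l₁, x, l₂, i, hlx, hm⟩ := moveRight_listSum_cases _ j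
  obtain ⟨m₁, m₂', rfl, rfl, hm₂⟩ := List.map_eq_append_iff.1 hlx
  obtain ⟨a, m₂, rfl, rfl, rfl⟩ := List.map_eq_cons_iff.1 hm₂
  refine h a ↑(m₁ ++ m₂) ?_ i ?_
  · exact Multiset.coe_eq_coe.2 List.perm_middle
  · rw [hm] at hj
    have hj' := Game.of_le_of.2 hj
    rw [of_listSum] at hj'
    rw [Multiset.map_coe, Multiset.sum_coe]
    refine le_of_eq_of_le ?_ hj'
    simp only [List.map_append, List.map_cons, List.sum_append, List.sum_cons, List.map_map,
      Function.comp_def]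
    abel

theorem not_add_le_zero_of_moveLeft {x : PGame.{u}} {g : Game.{u}} (i : x.LeftMoves)
    (h : 0 ≤ Game.of (x.moveLeft i) + g) : ¬ Game.of x + g ≤ 0 := by
  obtain ⟨y, rfl⟩ := Game.of_surjective g
  cases x; cases y
  exact not_le_of_le_moveLeft (y := mk _ _ _ _ + mk _ _ _ _) (Sum.inl i) h

theorem wellFounded_cutExpand_option {β : Type*} :
    WellFounded (Relation.CutExpand fun p q : PGame.{u} × β => IsOption p.1 q.1) :=
  (InvImage.wf Prod.fst wf_isOption).cutExpand

end PGame

/-! ### Thermographs on a grid of temperatures -/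

/-- A pair of walls of a thermograph. Relative to a grid parameter `N`, the index `n : ℕ` stands
for the temperature `n / N - 1` (the lowest temperature is `-1`) and an integer value `z` of a wall
stands for the position `z / N`. -/
structure Walls where
  /-- The left wall. -/
  left : ℕ → ℤ
  /-- The right wall. -/
  right : ℕ → ℤ

namespace Walls

/-- The index `n` is strictly above the foot of the mast: the walls agree there, and neither
has changed since the index before. -/
def OnMast (w : Walls) (n : ℕ) : Prop :=
  ∃ m, n = m + 1 ∧ w.left n = w.right n ∧ w.left m = w.left n ∧ w.right m = w.right n

/-- The walls `w` are the walls of a game whose left and right options have the walls `wl` and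
`wr`. A move at index `n` costs the temperature, that is `n - N` units of the grid. Below the
mast each wall is attained by an option. At the lowest temperature walls that would fail to meet
are closed by a mast at the point nearest to `0` between them; hence the disjuncts on `n = 0`. -/
structure Fits (N : ℕ) {ι κ : Type*} (wl : ι → Walls) (wr : κ → Walls) (w : Walls) : Prop where
  right_le_left : ∀ n, w.right n ≤ w.left n
  left_step : ∀ n, w.left n - 1 ≤ w.left (n + 1) ∧ w.left (n + 1) ≤ w.left n
  right_step : ∀ n, w.right n ≤ w.right (n + 1) ∧ w.right (n + 1) ≤ w.right n + 1
  left_ge : ∀ i n, (wl i).right n - (n - N) ≤ w.left n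
  right_le : ∀ j n, w.right n ≤ (wr j).left n + (n - N)
  left_attained : ∀ n, (∃ i, w.left n = (wl i).right n - (n - N)) ∨ w.OnMast n ∨
    (n = 0 ∧ w.left 0 = w.right 0 ∧ w.left 0 ≤ 0)
  right_attained : ∀ n, (∃ j, w.right n = (wr j).left n + (n - N)) ∨ w.OnMast n ∨
    (n = 0 ∧ w.left 0 = w.right 0 ∧ 0 ≤ w.left 0)
  eventually_const : ∃ (T : ℕ) (M : ℤ), ∀ n, T ≤ n → w.left n = M ∧ w.right n = M

end Walls

/-- `IsThermograph N x w`: the walls `w` form the thermograph of the game `x` on the grid with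
parameter `N`. -/
inductive IsThermograph (N : ℕ) : PGame.{u} → Walls → Prop
  | intro {x : PGame.{u}} {w : Walls} (wl : x.LeftMoves → Walls) (wr : x.RightMoves → Walls)
    (hl : ∀ i, IsThermograph N (x.moveLeft i) (wl i))
    (hr : ∀ j, IsThermograph N (x.moveRight j) (wr j))
    (h : w.Fits N wl wr) : IsThermograph N x w

namespace IsThermograph

variable {N : ℕ}

theorem exists_fits {x : PGame.{u}} {w : Walls} (h : IsThermograph N x w) :
    ∃ (wl : x.LeftMoves → Walls) (wr : x.RightMoves → Walls),
      (∀ i, IsThermograph N (x.moveLeft i) (wl i)) ∧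
      (∀ j, IsThermograph N (x.moveRight j) (wr j)) ∧ w.Fits N wl wr := by
  cases h with
  | intro wl wr hl hr h => exact ⟨wl, wr, hl, hr, h⟩

theorem neg {x : PGame.{u}} {w : Walls} (h : IsThermograph N x w) :
    IsThermograph N (-x) ⟨fun n => -w.right n, fun n => -w.left n⟩ := by
  induction x generalizing w with
  | mk l r L R ihl ihr =>
  obtain ⟨wl, wr, hl, hr, h⟩ := h.exists_fits
  refine .intro (x := PGame.mk _ _ _ _)
    (fun j => ⟨fun n => -(wr j).right n, fun n => -(wr j).left n⟩)
    (fun i => ⟨fun n => -(wl i).right n, fun n => -(wl i).left n⟩)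
    (fun j => ihr j (hr j)) (fun i => ihl i (hl i)) ?_
  constructor
  · intro n; have := h.right_le_left n; simp only; omega
  · intro n; have := h.right_step n; simp only; omega
  · intro n; have := h.left_step n; simp only; omega
  · intro i n; have := h.right_le i n; simp only; omega
  · intro i n; have := h.left_ge i n; simp only; omega
  · intro n
    rcases h.right_attained n with ⟨j, hj⟩ | ⟨m, hm⟩ | h0
    · exact Or.inl ⟨j, by simp only; omega⟩
    · exact Or.inr (Or.inl ⟨m, by simp only; omega⟩)
    · exact Or.inr (Or.inr (by simp only; omega))
  · intro n
    rcases h.left_attained n with ⟨j, hj⟩ | ⟨m, hm⟩ | h0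
    · exact Or.inl ⟨j, by simp only; omega⟩
    · exact Or.inr (Or.inl ⟨m, by simp only; omega⟩)
    · exact Or.inr (Or.inr (by simp only; omega))
  · obtain ⟨T, M, hT⟩ := h.eventually_const
    exact ⟨T, -M, fun n hn => by have := hT n hn; simp only; omega⟩

theorem zero (N : ℕ) : IsThermograph N (0 : PGame.{u}) ⟨fun _ => 0, fun _ => 0⟩ := by
  refine .intro (fun i => i.elim) (fun i => i.elim) (fun i => i.elim) (fun i => i.elim) ?_
  have hm : ∀ n, (⟨fun _ => 0, fun _ => 0⟩ : Walls).OnMast n ∨ n = 0 := fun n => by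
    rcases n with _ | n
    · exact Or.inr rfl
    · exact Or.inl ⟨n, rfl, rfl, rfl, rfl⟩
  refine ⟨by simp, by simp, by simp, fun i => i.elim, fun i => i.elim, fun n => ?_, fun n => ?_,
    0, 0, by simp⟩
  all_goals
    right
    rcases hm n with h | h
    · exact Or.inl h
    · exact Or.inr ⟨h, rfl, le_rfl⟩

theorem one (N : ℕ) : IsThermograph N (1 : PGame.{u}) ⟨fun _ => N, fun _ => N⟩ := by
  refine .intro (fun _ => ⟨fun _ => 0, fun _ => 0⟩) (fun i => i.elim) (fun _ => zero N)
    (fun i => i.elim) ?_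
  have hm : ∀ n, (⟨fun _ => N, fun _ => N⟩ : Walls).OnMast n ∨ n = 0 := fun n => by
    rcases n with _ | n
    · exact Or.inr rfl
    · exact Or.inl ⟨n, rfl, rfl, rfl, rfl⟩
  refine ⟨by simp, by simp, by simp, fun i n => by simp, fun i => i.elim, fun n => ?_,
    fun n => ?_, 0, N, by simp⟩
  · rcases hm n with h | rfl
    · exact Or.inr (Or.inl h)
    · exact Or.inl ⟨PUnit.unit, by simp⟩
  · rcases hm n with h | rfl
    · exact Or.inr (Or.inl h)
    · exact Or.inr (Or.inr ⟨rfl, rfl, by simp⟩)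

/-! ### The thermostatic strategy -/

/-- The thermostatic strategy for Left in a sum of games with known thermographs. At an ambient
temperature `t`, Left wins moving second if the right walls add up to more than `t`, and wins
moving first if their sum, with one of them replaced by the left wall of the same component, is
positive. Left answers at the highest temperature `≤ t` at which some component is not on its
mast, by the move that attains the left wall of that component. -/
theorem left_wins_sum (s : Multiset (PGame.{u} × Walls))
    (hs : ∀ p ∈ s, IsThermograph N p.1 p.2) :
    (∀ n : ℕ, (n : ℤ) - N < (s.map fun p => p.2.right n).sum →
      0 ≤ (s.map fun p => Game.of p.1).sum) ∧
    (∀ (n : ℕ) (p : PGame.{u} × Walls) (s' : Multiset (PGame.{u} × Walls)), s = p ::ₘ s' →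
      0 < p.2.left n + (s'.map fun p => p.2.right n).sum →
      ¬ (s.map fun p => Game.of p.1).sum ≤ 0) := by
  induction s using PGame.wellFounded_cutExpand_option.induction with
  | _ s ih =>
  constructor
  · intro n hn
    refine PGame.zero_le_sum_of_moveRight Prod.fst s fun p s' hps j => ?_
    subst hps
    obtain ⟨wl, wr, hl, hr, hw⟩ := (hs p (Multiset.mem_cons_self _ _)).exists_fits
    have key := (ih ((p.1.moveRight j, wr j) ::ₘ s') ?_ ?_).2 n _ s' rfl ?_
    · simpa using key
    · rw [← Multiset.singleton_add, ← Multiset.singleton_add]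
      exact Relation.cutExpand_single_add
        (r := fun p q : PGame.{u} × Walls => PGame.IsOption p.1 q.1)
        (PGame.IsOption.moveRight j) s'
    · intro q hq
      rcases Multiset.mem_cons.1 hq with rfl | hq
      · exact hr j
      · exact hs q (Multiset.mem_cons_of_mem hq)
    · have := hw.right_le j n
      rw [Multiset.map_cons, Multiset.sum_cons] at hn
      simp only; omega
  · -- A component with a left option attaining its left wall at index `n` allows the strategy's
    -- move there.
    have move : ∀ (n : ℕ) (p : PGame.{u} × Walls) (s' : Multiset (PGame.{u} × Walls))
        (wl : p.1.LeftMoves → Walls) (i : p.1.LeftMoves), s = p ::ₘ s' →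
        (∀ i, IsThermograph N (p.1.moveLeft i) (wl i)) →
        p.2.left n = (wl i).right n - (n - N) →
        0 < p.2.left n + (s'.map fun p => p.2.right n).sum →
        ¬ (s.map fun p => Game.of p.1).sum ≤ 0 := by
      intro n p s' wl i hps hl hi hpos
      subst hps
      rw [Multiset.map_cons, Multiset.sum_cons]
      refine PGame.not_add_le_zero_of_moveLeft i ?_
      have key := (ih ((p.1.moveLeft i, wl i) ::ₘ s') ?_ ?_).1 n ?_
      · simpa using key
      · rw [← Multiset.singleton_add, ← Multiset.singleton_add]
        exact Relation.cutExpand_single_add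
          (r := fun p q : PGame.{u} × Walls => PGame.IsOption p.1 q.1)
          (PGame.IsOption.moveLeft i) s'
      · intro q hq
        rcases Multiset.mem_cons.1 hq with rfl | hq
        · exact hl i
        · exact hs q (Multiset.mem_cons_of_mem hq)
      · rw [Multiset.map_cons, Multiset.sum_cons]
        simp only; omega
    intro n
    induction n with
    | zero =>
      intro p s' hps hpos hcon
      -- Otherwise no left wall is attained by an option, so that all walls are `≤ 0`.
      have hq : ∀ q ∈ s, ∀ s'', s = q ::ₘ s'' →
          0 < q.2.left 0 + (s''.map fun p => p.2.right 0).sum →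
          q.2.left 0 = q.2.right 0 ∧ q.2.left 0 ≤ 0 := by
        intro q hqs s'' hs'' h0
        obtain ⟨wl, wr, hl, -, hw⟩ := (hs q hqs).exists_fits
        rcases hw.left_attained 0 with ⟨i, hi⟩ | ⟨m, hm, -⟩ | ⟨-, h⟩
        · exact absurd hcon (move 0 q s'' wl i hs'' hl hi h0)
        · omega
        · exact h
      have hp := hq p (by simp [hps]) s' hps hpos
      have hsum : (s.map fun p => p.2.right 0).sum ≤ 0 := by
        refine (Multiset.sum_le_card_nsmul _ 0 fun z hz => ?_).trans_eq (smul_zero _)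
        obtain ⟨q, hqs, rfl⟩ := Multiset.mem_map.1 hz
        obtain ⟨s'', hs''⟩ := Multiset.exists_cons_of_mem hqs
        have hge : q.2.right 0 ≤ q.2.left 0 := by
          obtain ⟨_, _, -, -, hw⟩ := (hs q hqs).exists_fits
          exact hw.right_le_left 0
        have htot : p.2.right 0 + (s'.map fun p => p.2.right 0).sum =
            q.2.right 0 + (s''.map fun p => p.2.right 0).sum := by
          rw [← Multiset.sum_cons, ← Multiset.sum_cons,
            ← Multiset.map_cons (fun p : PGame.{u} × Walls => p.2.right 0),
            ← Multiset.map_cons (fun p : PGame.{u} × Walls => p.2.right 0), ← hps, ← hs'']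
        have := hq q hqs s'' hs'' (by omega)
        omega
      rw [hps, Multiset.map_cons, Multiset.sum_cons] at hsum
      omega
    | succ n ihn =>
      intro p s' hps hpos hcon
      -- Otherwise all components are on their masts, and the temperature can be lowered.
      have hq : ∀ q ∈ s, ∀ s'', s = q ::ₘ s'' →
          0 < q.2.left (n + 1) + (s''.map fun p => p.2.right (n + 1)).sum →
          q.2.OnMast (n + 1) := by
        intro q hqs s'' hs'' h0
        obtain ⟨wl, wr, hl, -, hw⟩ := (hs q hqs).exists_fits
        rcases hw.left_attained (n + 1) with ⟨i, hi⟩ | h | ⟨h, -⟩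
        · exact absurd hcon (move (n + 1) q s'' wl i hs'' hl hi h0)
        · exact h
        · omega
      obtain ⟨m, hm, hp₁, hp₂, hp₃⟩ := hq p (by simp [hps]) s' hps hpos
      obtain rfl : n = m := by omega
      have hsum : (s'.map fun p => p.2.right n) = s'.map fun p => p.2.right (n + 1) := by
        refine Multiset.map_congr rfl fun q hqs' => ?_
        have hqs : q ∈ s := by simp [hps, hqs']
        obtain ⟨s'', hs''⟩ := Multiset.exists_cons_of_mem hqs
        have hge : q.2.right (n + 1) ≤ q.2.left (n + 1) := by
          obtain ⟨_, _, -, -, hw⟩ := (hs q hqs).exists_fits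
          exact hw.right_le_left (n + 1)
        have htot : p.2.right (n + 1) + (s'.map fun p => p.2.right (n + 1)).sum =
            q.2.right (n + 1) + (s''.map fun p => p.2.right (n + 1)).sum := by
          rw [← Multiset.sum_cons, ← Multiset.sum_cons,
            ← Multiset.map_cons (fun p : PGame.{u} × Walls => p.2.right (n + 1)),
            ← Multiset.map_cons (fun p : PGame.{u} × Walls => p.2.right (n + 1)), ← hps, ← hs'']
        obtain ⟨m, hm, -, -, h⟩ := hq q hqs s'' hs'' (by omega)
        obtain rfl : n = m := by omega
        exact h
      exact ihn p s' hps (by rw [hsum]; omega) hcon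

end IsThermograph
/-! ### Refining the grid -/

namespace Walls

/-- The same walls on the grid with half the mesh, by linear interpolation. -/
def refine (w : Walls) : Walls where
  left n := w.left (n / 2) + w.left ((n + 1) / 2)
  right n := w.right (n / 2) + w.right ((n + 1) / 2)

theorem refine_left_even (w : Walls) (k : ℕ) : w.refine.left (2 * k) = 2 * w.left k := by
  have h₁ : 2 * k / 2 = k := by omega
  have h₂ : (2 * k + 1) / 2 = k := by omega
  simp only [refine, h₁, h₂]; ring

theorem refine_left_odd (w : Walls) (k : ℕ) :
    w.refine.left (2 * k + 1) = w.left k + w.left (k + 1) := by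
  have h₁ : (2 * k + 1) / 2 = k := by omega
  have h₂ : (2 * k + 1 + 1) / 2 = k + 1 := by omega
  simp only [refine, h₁, h₂]

theorem refine_right_even (w : Walls) (k : ℕ) : w.refine.right (2 * k) = 2 * w.right k := by
  have h₁ : 2 * k / 2 = k := by omega
  have h₂ : (2 * k + 1) / 2 = k := by omega
  simp only [refine, h₁, h₂]; ring

theorem refine_right_odd (w : Walls) (k : ℕ) :
    w.refine.right (2 * k + 1) = w.right k + w.right (k + 1) := by
  have h₁ : (2 * k + 1) / 2 = k := by omega
  have h₂ : (2 * k + 1 + 1) / 2 = k + 1 := by omega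
  simp only [refine, h₁, h₂]

variable {N : ℕ} {ι κ : Type*} {wl : ι → Walls} {wr : κ → Walls} {w : Walls}

theorem OnMast.refine_even {k : ℕ} (h : w.OnMast k) : w.refine.OnMast (2 * k) := by
  obtain ⟨m, rfl, h₁, h₂, h₃⟩ := h
  refine ⟨2 * m + 1, by ring, ?_, ?_, ?_⟩ <;>
    simp only [refine_left_even, refine_left_odd, refine_right_even, refine_right_odd] <;> omega

theorem OnMast.refine_odd {k : ℕ} (h : w.OnMast (k + 1)) : w.refine.OnMast (2 * k + 1) := by
  obtain ⟨m, hm, h₁, h₂, h₃⟩ := h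
  obtain rfl : k = m := by omega
  refine ⟨2 * k, rfl, ?_, ?_, ?_⟩ <;>
    simp only [refine_left_even, refine_left_odd, refine_right_even, refine_right_odd] <;> omega

/-- At an odd index of the finer grid, one and the same option has to attain the wall at both
neighbouring indices of the coarser grid; the bounds on the slopes of the walls provide it. -/
theorem Fits.refine (h : w.Fits N wl wr)
    (hl : ∀ i n, (wl i).right n ≤ (wl i).right (n + 1) ∧
      (wl i).right (n + 1) ≤ (wl i).right n + 1)
    (hr : ∀ j n, (wr j).left n - 1 ≤ (wr j).left (n + 1) ∧
      (wr j).left (n + 1) ≤ (wr j).left n) :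
    w.refine.Fits (2 * N) (fun i => (wl i).refine) fun j => (wr j).refine := by
  constructor
  · intro n
    exact add_le_add (h.right_le_left _) (h.right_le_left _)
  · intro n
    have := h.left_step (n / 2)
    have e : (n + 1 + 1) / 2 = n / 2 + 1 := by omega
    simp only [Walls.refine, e]; omega
  · intro n
    have := h.right_step (n / 2)
    have e : (n + 1 + 1) / 2 = n / 2 + 1 := by omega
    simp only [Walls.refine, e]; omega
  · intro i n
    have := h.left_ge i (n / 2)
    have := h.left_ge i ((n + 1) / 2)
    simp only [Walls.refine]; push_cast; omega
  · intro j n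
    have := h.right_le j (n / 2)
    have := h.right_le j ((n + 1) / 2)
    simp only [Walls.refine]; push_cast; omega
  · intro n
    obtain ⟨k, rfl | rfl⟩ := Nat.even_or_odd' n
    · rcases h.left_attained k with ⟨i, hi⟩ | hm | ⟨rfl, h₁, h₂⟩
      · refine Or.inl ⟨i, ?_⟩
        rw [refine_left_even, refine_right_even]; push_cast; omega
      · exact Or.inr (Or.inl hm.refine_even)
      · refine Or.inr (Or.inr ⟨rfl, ?_⟩)
        simp only [Walls.refine, Nat.zero_div, zero_add, Nat.reduceDiv]; omega
    · have hs := h.left_step k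
      have hs' := h.right_step k
      have hle := h.right_le_left (k + 1)
      rcases h.left_attained (k + 1) with ⟨i, hi⟩ | hm | ⟨h₀, -⟩
      · rcases h.left_attained k with ⟨i', hi'⟩ | hfoot
        · left
          have := hl i k
          have := hl i' k
          have := h.left_ge i k
          have := h.left_ge i' (k + 1)
          by_cases hc : w.left (k + 1) = w.left k
          · refine ⟨i, ?_⟩
            rw [refine_left_odd, refine_right_odd]; push_cast at *; omega
          · refine ⟨i', ?_⟩
            rw [refine_left_odd, refine_right_odd]; push_cast at *; omega
        · have heq : w.left k = w.right k := by
            rcases hfoot with ⟨m, -, hm, -⟩ | ⟨rfl, h₁, -⟩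
            · exact hm
            · exact h₁
          left
          have := hl i k
          have := h.left_ge i k
          refine ⟨i, ?_⟩
          rw [refine_left_odd, refine_right_odd]; push_cast at *; omega
      · exact Or.inr (Or.inl hm.refine_odd)
      · omega
  · intro n
    obtain ⟨k, rfl | rfl⟩ := Nat.even_or_odd' n
    · rcases h.right_attained k with ⟨i, hi⟩ | hm | ⟨rfl, h₁, h₂⟩
      · refine Or.inl ⟨i, ?_⟩
        rw [refine_left_even, refine_right_even]; push_cast; omega
      · exact Or.inr (Or.inl hm.refine_even)
      · refine Or.inr (Or.inr ⟨rfl, ?_⟩)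
        simp only [Walls.refine, Nat.zero_div, zero_add, Nat.reduceDiv]; omega
    · have hs := h.left_step k
      have hs' := h.right_step k
      have hle := h.right_le_left (k + 1)
      rcases h.right_attained (k + 1) with ⟨i, hi⟩ | hm | ⟨h₀, -⟩
      · rcases h.right_attained k with ⟨i', hi'⟩ | hfoot
        · left
          have := hr i k
          have := hr i' k
          have := h.right_le i k
          have := h.right_le i' (k + 1)
          by_cases hc : w.right (k + 1) = w.right k
          · refine ⟨i, ?_⟩
            rw [refine_left_odd, refine_right_odd]; push_cast at *; omega
          · refine ⟨i', ?_⟩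
            rw [refine_left_odd, refine_right_odd]; push_cast at *; omega
        · have heq : w.left k = w.right k := by
            rcases hfoot with ⟨m, -, hm, -⟩ | ⟨rfl, h₁, -⟩
            · exact hm
            · exact h₁
          left
          have := hr i k
          have := h.right_le i k
          refine ⟨i, ?_⟩
          rw [refine_left_odd, refine_right_odd]; push_cast at *; omega
      · exact Or.inr (Or.inl hm.refine_odd)
      · omega
  · obtain ⟨T, M, hT⟩ := h.eventually_const
    refine ⟨2 * T, 2 * M, fun n hn => ?_⟩
    have h₁ := hT (n / 2) (by omega)
    have h₂ := hT ((n + 1) / 2) (by omega)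
    simp only [Walls.refine]; omega

end Walls

namespace IsThermograph

variable {N : ℕ}

theorem left_step {x : PGame.{u}} {w : Walls} (h : IsThermograph N x w) (n : ℕ) :
    w.left n - 1 ≤ w.left (n + 1) ∧ w.left (n + 1) ≤ w.left n := by
  obtain ⟨_, _, -, -, hw⟩ := h.exists_fits
  exact hw.left_step n

theorem right_step {x : PGame.{u}} {w : Walls} (h : IsThermograph N x w) (n : ℕ) :
    w.right n ≤ w.right (n + 1) ∧ w.right (n + 1) ≤ w.right n + 1 := by
  obtain ⟨_, _, -, -, hw⟩ := h.exists_fits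
  exact hw.right_step n

theorem refine {x : PGame.{u}} {w : Walls} (h : IsThermograph N x w) :
    IsThermograph (2 * N) x w.refine := by
  induction h with
  | intro wl wr hl hr h ihl ihr =>
    exact .intro _ _ ihl ihr (h.refine (fun i => (hl i).right_step) fun j => (hr j).left_step)

/-- On a refined grid, the walls take even values at even indices. -/
theorem exists_refine_pow {x : PGame.{u}} {k : ℕ} {w : Walls} (h : IsThermograph (2 ^ k) x w)
    {m : ℕ} (hm : k < m) :
    ∃ w', IsThermograph (2 ^ m) x w' ∧ ∀ n, 2 ∣ w'.left (2 * n) ∧ 2 ∣ w'.right (2 * n) := by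
  induction m, hm using Nat.le_induction with
  | base =>
    refine ⟨w.refine, by rw [pow_succ']; exact h.refine, fun n => ?_⟩
    rw [Walls.refine_left_even, Walls.refine_right_even]
    exact ⟨dvd_mul_right _ _, dvd_mul_right _ _⟩
  | succ m _ ih =>
    obtain ⟨w', h', -⟩ := ih
    refine ⟨w'.refine, by rw [pow_succ']; exact h'.refine, fun n => ?_⟩
    rw [Walls.refine_left_even, Walls.refine_right_even]
    exact ⟨dvd_mul_right _ _, dvd_mul_right _ _⟩

end IsThermograph

/-! ### Short games have thermographs -/

/-- Given a finite set of lower bounds lying below a finite set of upper bounds, the integer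
nearest to `0` between them. -/
theorem exists_between_nearest_zero {S S' : Set ℤ} (hS : S.Finite) (hS' : S'.Finite)
    (h : ∀ s ∈ S, ∀ s' ∈ S', s ≤ s') :
    ∃ m, (∀ s ∈ S, s ≤ m) ∧ (∀ s' ∈ S', m ≤ s') ∧ (m ∈ S ∨ m ≤ 0) ∧ (m ∈ S' ∨ 0 ≤ m) := by
  by_cases h₁ : ∃ s ∈ S, 0 < s
  · obtain ⟨s, hs, hpos⟩ := h₁
    obtain ⟨m, hm, hmax⟩ := Set.exists_max_image S id hS ⟨s, hs⟩
    exact ⟨m, hmax, h m hm, Or.inl hm, Or.inr (hpos.le.trans (hmax s hs))⟩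
  by_cases h₂ : ∃ s ∈ S', s < 0
  · obtain ⟨s, hs, hneg⟩ := h₂
    obtain ⟨m, hm, hmin⟩ := Set.exists_min_image S' id hS' ⟨s, hs⟩
    exact ⟨m, fun t ht => h t ht m hm, hmin, Or.inr ((hmin s hs).trans hneg.le), Or.inl hm⟩
  push Not at h₁ h₂
  exact ⟨0, h₁, h₂, Or.inr le_rfl, Or.inr le_rfl⟩

/-- Options with finitely many different walls determine walls of the game. If the walls of the
options are even at even indices, the scaffolds of the game meet at an index of the grid: the
distance between them shrinks by at most `2` per step and is even at even indices. -/
theorem Walls.exists_fits {N : ℕ} (hN : 2 ∣ N) {ι κ : Type*} {wl : ι → Walls} {wr : κ → Walls}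
    (hfl : (Set.range wl).Finite) (hfr : (Set.range wr).Finite)
    (hl : ∀ i n, (wl i).right n ≤ (wl i).right (n + 1) ∧
      (wl i).right (n + 1) ≤ (wl i).right n + 1)
    (hr : ∀ j n, (wr j).left n - 1 ≤ (wr j).left (n + 1) ∧
      (wr j).left (n + 1) ≤ (wr j).left n)
    (hbdd : ∀ i, ∃ C, ∀ n, (wl i).right n ≤ C)
    (hel : ∀ i n, 2 ∣ (wl i).right (2 * n)) (her : ∀ j n, 2 ∣ (wr j).left (2 * n)) :
    ∃ w : Walls, w.Fits N wl wr := by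
  by_cases hmeet : ∀ i j, (wl i).right 0 + N ≤ (wr j).left 0 - N
  · -- The scaffolds do not cross: the thermograph is a mast.
    obtain ⟨m, hm₁, hm₂, hm₃, hm₄⟩ := exists_between_nearest_zero
      (S := Set.range fun i => (wl i).right 0 + (N : ℤ))
      (S' := Set.range fun j => (wr j).left 0 - (N : ℤ))
      ((hfl.image fun w : Walls => w.right 0 + (N : ℤ)).subset <| by
        rintro _ ⟨i, rfl⟩; exact ⟨wl i, ⟨i, rfl⟩, rfl⟩)
      ((hfr.image fun w : Walls => w.left 0 - (N : ℤ)).subset <| by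
        rintro _ ⟨i, rfl⟩; exact ⟨wr i, ⟨i, rfl⟩, rfl⟩)
      (by rintro _ ⟨i, rfl⟩ _ ⟨j, rfl⟩; exact hmeet i j)
    have hm : ∀ n, (⟨fun _ => m, fun _ => m⟩ : Walls).OnMast n ∨ n = 0 := fun n => by
      rcases n with _ | n
      · exact Or.inr rfl
      · exact Or.inl ⟨n, rfl, rfl, rfl, rfl⟩
    refine ⟨⟨fun _ => m, fun _ => m⟩, by simp, by simp, by simp, fun i n => ?_, fun j n => ?_,
      fun n => ?_, fun n => ?_, 0, m, by simp⟩
    · have h₀ := hm₁ _ ⟨i, rfl⟩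
      have : (wl i).right n ≤ (wl i).right 0 + n := by
        induction n with
        | zero => simp
        | succ n ih => have := hl i n; push_cast; omega
      simp only at *; omega
    · have h₀ := hm₂ _ ⟨j, rfl⟩
      have : (wr j).left 0 - n ≤ (wr j).left n := by
        induction n with
        | zero => simp
        | succ n ih => have := hr j n; push_cast; omega
      simp only at *; omega
    · rcases hm n with h | rfl
      · exact Or.inr (Or.inl h)
      · rcases hm₃ with ⟨i, hi⟩ | h
        · exact Or.inl ⟨i, by simp only at *; push_cast; omega⟩
        · exact Or.inr (Or.inr ⟨rfl, rfl, h⟩)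
    · rcases hm n with h | rfl
      · exact Or.inr (Or.inl h)
      · rcases hm₄ with ⟨i, hi⟩ | h
        · exact Or.inl ⟨i, by simp only at *; push_cast; omega⟩
        · exact Or.inr (Or.inr ⟨rfl, rfl, h⟩)
  · push Not at hmeet
    obtain ⟨i₀, j₀, h₀⟩ := hmeet
    have hmaxl : ∀ n, ∃ i, ∀ i', (wl i').right n ≤ (wl i).right n := fun n => by
      obtain ⟨_, ⟨i, rfl⟩, hi⟩ := Set.exists_max_image (Set.range wl) (fun w => w.right n) hfl
        ⟨_, i₀, rfl⟩
      exact ⟨i, fun i' => hi _ ⟨i', rfl⟩⟩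
    have hminr : ∀ n, ∃ j, ∀ j', (wr j).left n ≤ (wr j').left n := fun n => by
      obtain ⟨_, ⟨j, rfl⟩, hj⟩ := Set.exists_min_image (Set.range wr) (fun w => w.left n) hfr
        ⟨_, j₀, rfl⟩
      exact ⟨j, fun j' => hj _ ⟨j', rfl⟩⟩
    choose il hil using hmaxl
    choose jr hjr using hminr
    -- The scaffolds, that is the walls before the mast is added.
    obtain ⟨l, hldef⟩ : ∃ l : ℕ → ℤ, ∀ n, l n = (wl (il n)).right n - (n - N) := ⟨_, fun _ => rfl⟩
    obtain ⟨r, hrdef⟩ : ∃ r : ℕ → ℤ, ∀ n, r n = (wr (jr n)).left n + (n - N) := ⟨_, fun _ => rfl⟩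
    have hlstep : ∀ n, l n - 1 ≤ l (n + 1) ∧ l (n + 1) ≤ l n := fun n => by
      have h₁ := hldef n
      have h₂ := hldef (n + 1)
      have := hl (il n) n
      have := hl (il (n + 1)) n
      have := hil n (il (n + 1))
      have := hil (n + 1) (il n)
      push_cast at *; omega
    have hrstep : ∀ n, r n ≤ r (n + 1) ∧ r (n + 1) ≤ r n + 1 := fun n => by
      have h₁ := hrdef n
      have h₂ := hrdef (n + 1)
      have := hr (jr n) n
      have := hr (jr (n + 1)) n
      have := hjr n (jr (n + 1))
      have := hjr (n + 1) (jr n)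
      push_cast at *; omega
    have hlanti : Antitone l := antitone_nat_of_succ_le fun n => (hlstep n).2
    have hrmono : Monotone r := monotone_nat_of_le_succ fun n => (hrstep n).1
    have hcross : ∃ n, l n ≤ r n := by
      have hb : ∀ w ∈ Set.range wl, ∃ C, ∀ n, w.right n ≤ C := by
        rintro _ ⟨i, rfl⟩; exact hbdd i
      choose! C hC using hb
      obtain ⟨D, hD⟩ := (hfl.image C).bddAbove
      refine ⟨(D + N - r 0).toNat, ?_⟩
      have h₁ := hldef (D + N - r 0).toNat
      have h₂ := hC _ ⟨il (D + N - r 0).toNat, rfl⟩ (D + N - r 0).toNat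
      have h₃ := hD ⟨_, ⟨il (D + N - r 0).toNat, rfl⟩, rfl⟩
      have h₄ := hrmono (Nat.zero_le (D + N - r 0).toNat)
      have h₅ := Int.self_le_toNat (D + N - r 0)
      omega
    obtain ⟨T, hT, hTmin⟩ : ∃ T, l T ≤ r T ∧ ∀ m < T, r m < l m := by
      classical
      exact ⟨Nat.find hcross, Nat.find_spec hcross, fun m hm => not_le.1 (Nat.find_min hcross hm)⟩
    have hTeq : l T = r T := by
      have h00 : r 0 < l 0 := by
        have := hldef 0
        have := hrdef 0
        have := hil 0 i₀
        have := hjr 0 j₀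
        push_cast at *; omega
      obtain ⟨t, rfl⟩ : ∃ t, T = t + 1 := ⟨T - 1, by
        have : T ≠ 0 := by rintro rfl; omega
        omega⟩
      have h₁ := hTmin t (by omega)
      have h₂ := hlstep t
      have h₃ := hrstep t
      have hleven : ∀ k, 2 ∣ l (2 * k) := fun k => by
        have h₁ := hldef (2 * k)
        have h₂ := hel (il (2 * k)) k
        push_cast at h₁; omega
      have hreven : ∀ k, 2 ∣ r (2 * k) := fun k => by
        have h₁ := hrdef (2 * k)
        have h₂ := her (jr (2 * k)) k
        push_cast at h₁; omega
      obtain ⟨k, hk | hk⟩ := Nat.even_or_odd' t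
      · have h₄ := hleven k
        have h₅ := hreven k
        rw [← hk] at h₄ h₅
        omega
      · have h₄ := hleven (k + 1)
        have h₅ := hreven (k + 1)
        rw [show 2 * (k + 1) = t + 1 by omega] at h₄ h₅
        omega
    refine ⟨⟨fun n => l (min n T), fun n => r (min n T)⟩, fun n => ?_, fun n => ?_, fun n => ?_,
      fun i n => ?_, fun j n => ?_, fun n => ?_, fun n => ?_, T, l T, fun n hn => ?_⟩
    · rcases lt_or_ge n T with h | h
      · simpa [min_eq_left h.le] using (hTmin n h).le
      · simp [min_eq_right h, hTeq]
    · rcases lt_or_ge n T with h | h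
      · simpa only [min_eq_left h.le, min_eq_left (Nat.succ_le_of_lt h)] using hlstep n
      · simp [min_eq_right h, min_eq_right (h.trans n.le_succ)]
    · rcases lt_or_ge n T with h | h
      · simpa only [min_eq_left h.le, min_eq_left (Nat.succ_le_of_lt h)] using hrstep n
      · simp [min_eq_right h, min_eq_right (h.trans n.le_succ)]
    · have h₁ := hlanti (min_le_left n T)
      have h₂ := hldef n
      have h₃ := hil n i
      simp only; omega
    · have h₁ := hrmono (min_le_left n T)
      have h₂ := hrdef n
      have h₃ := hjr n j
      simp only; omega
    · rcases le_or_gt n T with h | h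
      · exact Or.inl ⟨il n, by simpa only [min_eq_left h] using hldef n⟩
      · refine Or.inr (Or.inl ⟨n - 1, by omega, ?_⟩)
        simp [min_eq_right h.le, min_eq_right (show T ≤ n - 1 by omega), hTeq]
    · rcases le_or_gt n T with h | h
      · exact Or.inl ⟨jr n, by simpa only [min_eq_left h] using hrdef n⟩
      · refine Or.inr (Or.inl ⟨n - 1, by omega, ?_⟩)
        simp [min_eq_right h.le, min_eq_right (show T ≤ n - 1 by omega), hTeq]
    · simp [min_eq_right hn, hTeq]

instance : Nonempty Walls := ⟨⟨0, 0⟩⟩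

theorem IsThermograph.right_bddAbove {N : ℕ} {x : PGame.{u}} {w : Walls}
    (h : IsThermograph N x w) : ∃ C, ∀ n, w.right n ≤ C := by
  obtain ⟨_, _, -, -, hw⟩ := h.exists_fits
  obtain ⟨T, M, hT⟩ := hw.eventually_const
  refine ⟨M, fun n => ?_⟩
  rw [← (hT (max n T) (le_max_right _ _)).2]
  exact monotone_nat_of_le_succ (fun n => (hw.right_step n).1) (le_max_left _ _)

theorem PGame.Short.of_isOption {x y : PGame.{u}} (hx : x.Short) (h : IsOption y x) : y.Short :=
  Set.Finite.subset hx fun _ hz => Relation.ReflTransGen.tail hz h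

theorem PGame.Short.finite_options {x : PGame.{u}} (hx : x.Short) : {y | IsOption y x}.Finite :=
  Set.Finite.subset hx fun _ hz => Relation.ReflTransGen.single hz

theorem PGame.Short.exists_isThermograph {x : PGame.{u}} (hx : x.Short) :
    ∃ k w, IsThermograph (2 ^ k) x w := by
  induction x using wf_isOption.induction with
  | _ x ih =>
  have ih' : ∀ y, IsOption y x → ∃ k w, IsThermograph (2 ^ k) y w :=
    fun y hy => ih y hy (hx.of_isOption hy)
  choose! k w hw using ih'
  obtain ⟨K, hK⟩ := (hx.finite_options.image k).bddAbove
  have hw' : ∀ y, IsOption y x → ∃ w', IsThermograph (2 ^ (K + 1)) y w' ∧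
      ∀ n, 2 ∣ w'.left (2 * n) ∧ 2 ∣ w'.right (2 * n) := fun y hy =>
    (hw y hy).exists_refine_pow (Nat.lt_succ_of_le (hK ⟨y, hy, rfl⟩))
  choose! w' hw' heven using hw'
  have hL := fun i => hw' _ (IsOption.moveLeft (x := x) i)
  have hR := fun j => hw' _ (IsOption.moveRight (x := x) j)
  obtain ⟨W, hW⟩ := Walls.exists_fits (N := 2 ^ (K + 1)) (dvd_pow_self 2 K.succ_ne_zero)
    (wl := fun i => w' (x.moveLeft i)) (wr := fun j => w' (x.moveRight j))
    ((hx.finite_options.image w').subset <| by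
      rintro _ ⟨i, rfl⟩; exact ⟨_, IsOption.moveLeft i, rfl⟩)
    ((hx.finite_options.image w').subset <| by
      rintro _ ⟨i, rfl⟩; exact ⟨_, IsOption.moveRight i, rfl⟩)
    (fun i => (hL i).right_step) (fun j => (hR j).left_step) (fun i => (hL i).right_bddAbove)
    (fun i n => (heven _ (.moveLeft i) n).2) (fun j n => (heven _ (.moveRight j) n).1)
  exact ⟨_, W, .intro _ _ hL hR hW⟩

/-! ### Mean values of short games -/

/-- Lower bound for multiples of a short game: `n · x` is at least every integer `b - a` that is
smaller than `n M / N` by more than a constant. It is the outcome of the thermostatic strategy in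
the sum of `n` copies of `x`, `a` copies of `1` and `b` copies of `-1`. -/
theorem IsThermograph.natCast_le_nsmul {N : ℕ} {x : PGame.{u}} {w : Walls}
    (h : IsThermograph N x w) {T : ℕ} {M : ℤ} (hT : w.right T = M) (n a b : ℕ)
    (hab : (T : ℤ) - N + b * N < n * M + a * N) :
    b • (1 : Game.{u}) ≤ n • Game.of x + a • 1 := by
  have key := (left_wins_sum (N := N)
    (Multiset.replicate n (x, w) + Multiset.replicate a ((1 : PGame.{u}), ⟨fun _ => N, fun _ => N⟩)
      + Multiset.replicate b (-(1 : PGame.{u}), ⟨fun _ => -N, fun _ => -N⟩)) ?_).1 T ?_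
  · simp only [Multiset.map_add, Multiset.map_replicate, Multiset.sum_add,
      Multiset.sum_replicate, Game.of_neg, Game.of_one, smul_neg] at key
    rwa [← sub_eq_add_neg, sub_nonneg] at key
  · intro p hp
    rcases Multiset.mem_add.1 hp with hp | hp
    · rcases Multiset.mem_add.1 hp with hp | hp
      · rw [Multiset.eq_of_mem_replicate hp]; exact h
      · rw [Multiset.eq_of_mem_replicate hp]; exact one N
    · rw [Multiset.eq_of_mem_replicate hp]; exact (one N).neg
  · simp only [Multiset.map_add, Multiset.map_replicate, Multiset.sum_add,
      Multiset.sum_replicate, hT, nsmul_eq_mul]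
    linarith

/-- `HasRatMean g q`: the games `n · g` differ from `n q` by a bounded amount, as far as can be
seen by comparison with integers. -/
def HasRatMean (g : Game.{u}) (q : ℚ) : Prop :=
  ∃ m : ℕ, ∀ (n : ℕ) (c : ℤ), ((c : ℚ) ≤ n * q - m → c • (1 : Game.{u}) ≤ n • g) ∧
    ((n * q + m : ℚ) ≤ c → n • g ≤ c • (1 : Game.{u}))

theorem IsThermograph.intCast_le_nsmul {N : ℕ} (hN : 0 < N) {x : PGame.{u}} {w : Walls}
    (h : IsThermograph N x w) {T : ℕ} {M : ℤ} (hT : w.right T = M) (n : ℕ) (c : ℤ)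
    (hc : (c : ℚ) ≤ n * (M / N) - T) : c • (1 : Game.{u}) ≤ n • Game.of x := by
  have hN' : (0 : ℚ) < N := by exact_mod_cast hN
  have h₁ : c * N + T * N ≤ n * M := by
    have h₂ := mul_le_mul_of_nonneg_right hc hN'.le
    have h₃ : (n * ((M : ℚ) / N) - T) * N = n * M - T * N := by field_simp
    rw [h₃] at h₂
    have h₄ : (c * N + T * N : ℚ) ≤ n * M := by linarith
    exact_mod_cast h₄
  obtain ⟨a, b, rfl⟩ : ∃ a b : ℕ, c = b - a := ⟨(-c).toNat, c.toNat, by omega⟩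
  have key := h.natCast_le_nsmul hT n a b (by nlinarith)
  rw [sub_smul, sub_le_iff_le_add]
  simpa using key

theorem PGame.Short.exists_hasRatMean {x : PGame.{u}} (hx : x.Short) :
    ∃ q, HasRatMean (Game.of x) q := by
  obtain ⟨k, w, h⟩ := hx.exists_isThermograph
  obtain ⟨_, _, -, -, hw⟩ := h.exists_fits
  obtain ⟨T, M, hT⟩ := hw.eventually_const
  obtain ⟨h₁, h₂⟩ := hT T le_rfl
  refine ⟨M / (2 ^ k : ℕ), T, fun n c => ⟨fun hc => ?_, fun hc => ?_⟩⟩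
  · exact h.intCast_le_nsmul (by positivity) h₂ n c hc
  · have key := h.neg.intCast_le_nsmul (T := T) (M := -M) (by positivity) (by simp [h₁]) n (-c) (by
      push_cast at hc ⊢
      rw [neg_div, mul_neg]
      linarith)
    rw [Game.of_neg, smul_neg, neg_smul] at key
    exact neg_le_neg_iff.1 key

theorem Game.zero_lt_one : (0 : Game.{u}) < 1 := by
  have h : ¬ (1 : PGame.{u}) ≤ 0 :=
    PGame.not_le_of_le_moveLeft (y := 1) PUnit.unit (PGame.le_refl 0)
  exact lt_iff_le_not_ge.2 ⟨PGame.le_iff.2 ⟨fun i => i.elim, fun j => j.elim⟩, h⟩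

namespace HasRatMean

theorem zero : HasRatMean (0 : Game.{u}) 0 := by
  refine ⟨0, fun n c => ⟨fun hc => ?_, fun hc => ?_⟩⟩
  · have hc' : 0 ≤ -c := by
      have : (c : ℚ) ≤ 0 := by simpa using hc
      exact neg_nonneg.2 (by exact_mod_cast this)
    rw [smul_zero, ← neg_nonneg, ← neg_smul]
    exact zsmul_nonneg Game.zero_lt_one.le hc'
  · have hc' : 0 ≤ c := by
      have : (0 : ℚ) ≤ c := by simpa using hc
      exact_mod_cast this
    rw [smul_zero]
    exact zsmul_nonneg Game.zero_lt_one.le hc'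

theorem add {g h : Game.{u}} {p q : ℚ} (hg : HasRatMean g p) (hh : HasRatMean h q) :
    HasRatMean (g + h) (p + q) := by
  obtain ⟨m₁, h₁⟩ := hg
  obtain ⟨m₂, h₂⟩ := hh
  refine ⟨m₁ + m₂ + 1, fun n c => ⟨fun hc => ?_, fun hc => ?_⟩⟩
  · push_cast at hc
    have hf := Int.floor_le (n * p - m₁)
    have hf' := Int.lt_floor_add_one (n * p - m₁)
    have e₁ := (h₁ n ⌊n * p - m₁⌋).1 hf
    have e₂ := (h₂ n (c - ⌊n * p - m₁⌋)).1 (by push_cast; linarith)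
    have e := add_le_add e₁ e₂
    rwa [← add_smul, add_sub_cancel, ← smul_add] at e
  · push_cast at hc
    have hf := Int.le_ceil (n * p + m₁)
    have hf' := Int.ceil_lt_add_one (n * p + m₁)
    have e₁ := (h₁ n ⌈n * p + m₁⌉).2 hf
    have e₂ := (h₂ n (c - ⌈n * p + m₁⌉)).2 (by push_cast; linarith)
    have e := add_le_add e₁ e₂
    rwa [← add_smul, add_sub_cancel, ← smul_add] at e

theorem nsmul {g : Game.{u}} {q : ℚ} (hg : HasRatMean g q) (k : ℕ) :
    HasRatMean (k • g) (k * q) := by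
  induction k with
  | zero => simpa using zero
  | succ k ih =>
    rw [succ_nsmul, Nat.cast_succ, add_mul, one_mul]
    exact ih.add hg

theorem sum {ι : Type*} (s : Finset ι) {g : ι → Game.{u}} {q : ι → ℚ}
    (h : ∀ i, HasRatMean (g i) (q i)) : HasRatMean (∑ i ∈ s, g i) (∑ i ∈ s, q i) := by
  classical
  induction s using Finset.induction_on with
  | empty => simpa using zero
  | insert i s hi ih => rw [Finset.sum_insert hi, Finset.sum_insert hi]; exact (h i).add ih

end HasRatMean

theorem HasRatMean.exists_nsmul_pos {g : Game.{u}} {q : ℚ} (h : HasRatMean g q) (hq : 0 < q) :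
    ∃ N : ℕ, ∀ n ≥ N, 0 < n • g := by
  obtain ⟨m, hm⟩ := h
  obtain ⟨N, hN⟩ := exists_nat_ge ((m + 1) / q)
  refine ⟨N, fun n hn => ?_⟩
  have hn' : (N : ℚ) ≤ n := by exact_mod_cast hn
  have h₁ : (m + 1 : ℚ) ≤ n * q := by
    rw [div_le_iff₀ hq] at hN
    exact hN.trans (mul_le_mul_of_nonneg_right hn' hq.le)
  have h₂ := (hm n 1).1 (by push_cast; linarith)
  rw [one_smul] at h₂
  exact Game.zero_lt_one.trans_le h₂

theorem HasRatMean.exists_nsmul_neg {g : Game.{u}} {q : ℚ} (h : HasRatMean g q) (hq : q < 0) :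
    ∃ N : ℕ, ∀ n ≥ N, n • g < 0 := by
  obtain ⟨m, hm⟩ := h
  obtain ⟨N, hN⟩ := exists_nat_ge ((m + 1) / -q)
  refine ⟨N, fun n hn => ?_⟩
  have hn' : (N : ℚ) ≤ n := by exact_mod_cast hn
  have h₁ : (m + 1 : ℚ) ≤ n * -q := by
    rw [div_le_iff₀ (neg_pos.2 hq)] at hN
    exact hN.trans (mul_le_mul_of_nonneg_right hn' (neg_pos.2 hq).le)
  have h₂ := (hm n (-1)).2 (by push_cast; linarith)
  rw [neg_smul, one_smul] at h₂
  exact h₂.trans_lt (neg_neg_iff_pos.2 Game.zero_lt_one)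

/-! ### Dyadic fractions, integers and real numbers as games -/

namespace PGame

theorem not_powHalf_le_zero (m : ℕ) : ¬ powHalf.{u} m ≤ 0 := by
  cases m
  · exact not_le_of_le_moveLeft (y := 1) PUnit.unit (PGame.le_refl 0)
  · exact not_le_of_le_moveLeft (y := mk _ _ _ _) PUnit.unit (PGame.le_refl 0)

theorem zero_le_powHalf (m : ℕ) : 0 ≤ powHalf.{u} m := by
  refine le_iff.2 ⟨fun i => i.elim, fun j => ?_⟩
  cases m with
  | zero => exact j.elim
  | succ m => exact not_powHalf_le_zero m

theorem powHalf_succ_le (m : ℕ) : powHalf.{u} (m + 1) ≤ powHalf m := by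
  induction m with
  | zero => exact le_iff.2 ⟨fun _ => not_powHalf_le_zero 0, fun j => j.elim⟩
  | succ m ih =>
    exact le_iff.2 ⟨fun _ => not_powHalf_le_zero _,
      fun _ => not_le_of_moveRight_le (x := powHalf (m + 2)) PUnit.unit ih⟩

theorem not_powHalf_le_succ (m : ℕ) : ¬ powHalf.{u} m ≤ powHalf (m + 1) :=
  not_le_of_moveRight_le (x := powHalf (m + 1)) PUnit.unit (PGame.le_refl _)

/-- `2⁻⁽ᵐ⁺¹⁾` is half of `2⁻ᵐ`. -/
theorem of_powHalf_succ_add_self (m : ℕ) :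
    Game.of (powHalf.{u} (m + 1)) + Game.of (powHalf (m + 1)) = Game.of (powHalf m) := by
  induction m using Nat.strong_induction_on with
  | _ m ih =>
  have hlt : ¬ powHalf.{u} m ≤ 0 + powHalf (m + 1) := fun h => by
    refine not_powHalf_le_succ m (Game.of_le_of.1 ?_)
    simpa [Game.of_add, Game.of_zero] using Game.of_le_of.2 h
  have hright : ∀ j : (powHalf.{u} m).RightMoves,
      ¬ (powHalf m).moveRight j ≤ powHalf (m + 1) + powHalf (m + 1) := fun j => by
    cases m with
    | zero => exact j.elim
    | succ m =>
      refine not_le_of_add_moveRight_le (y := powHalf (m + 2)) PUnit.unit ?_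
      refine Game.of_le_of.1 ((add_le_add_left (Game.of_le_of.2 (powHalf_succ_le (m + 1))) _).trans
        (ih m m.lt_succ_self).le)
  have hleft : ¬ powHalf.{u} (m + 1) + powHalf (m + 1) ≤ 0 := fun h => by
    refine not_powHalf_le_zero (m + 1) (Game.of_le_of.1 ?_)
    exact (le_add_of_nonneg_left (Game.of_le_of.2 (zero_le_powHalf (m + 1)))).trans
      (Game.of_le_of.2 h)
  have hpos : ¬ powHalf.{u} m + powHalf (m + 1) ≤ powHalf m := fun h => by
    refine not_powHalf_le_zero (m + 1) (Game.of_le_of.1 ?_)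
    simpa [Game.of_add, Game.of_zero] using Game.of_le_of.2 h
  refine Game.of_eq (x := powHalf (m + 1) + powHalf (m + 1)) (le_iff.2 ⟨?_, hright⟩)
    (le_iff.2 ⟨fun i => ?_, ?_⟩)
  · exact Sum.rec (fun _ => hlt) (fun _ h =>
      hlt (_root_.le_trans h (add_comm_le (powHalf (m + 1)) 0)))
  · cases m <;> exact hleft
  · exact Sum.rec (fun _ => hpos) (fun _ h =>
      hpos (_root_.le_trans (add_comm_le (powHalf m) (powHalf (m + 1))) h))

theorem of_natMul (n : ℕ) (x : PGame.{u}) : Game.of (natMul n x) = n • Game.of x := by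
  induction n with
  | zero => exact (zero_smul ℕ _).symm
  | succ n ih => rw [succ_nsmul, ← ih]; rfl

theorem of_intMul (z : ℤ) (x : PGame.{u}) : Game.of (intMul z x) = z • Game.of x := by
  cases z with
  | ofNat n => rw [Int.ofNat_eq_natCast, natCast_zsmul, ← of_natMul]; rfl
  | negSucc n =>
    rw [negSucc_zsmul, ← smul_neg, ← Game.of_neg, ← of_natMul]; rfl

theorem two_pow_smul_powHalf (m : ℕ) : (2 ^ m : ℤ) • Game.of (powHalf.{u} m) = 1 := by
  induction m with
  | zero => rw [pow_zero, one_smul]; rfl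
  | succ m ih => rw [pow_succ, mul_smul, two_smul, of_powHalf_succ_add_self, ih]

theorem of_dyadic (q : ℤ × ℕ) : Game.of (dyadic.{u} q) = q.1 • Game.of (powHalf q.2) :=
  of_intMul _ _

theorem of_dyadic_lt {q : ℤ × ℕ} {c : ℤ} (h : (q.1 : ℝ) / 2 ^ q.2 < c) :
    Game.of (dyadic.{u} q) < c • (1 : Game.{u}) := by
  have h' : 0 < c * 2 ^ q.2 - q.1 := by
    rw [div_lt_iff₀ (by positivity)] at h
    exact sub_pos.2 (by exact_mod_cast h)
  rw [of_dyadic, ← two_pow_smul_powHalf q.2, ← mul_smul, ← sub_pos, ← sub_smul]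
  exact zsmul_pos (lt_iff_le_not_ge.2 ⟨zero_le_powHalf q.2, not_powHalf_le_zero q.2⟩) h'

theorem isEmpty_rightMoves_natMul_one (n : ℕ) : IsEmpty (natMul.{u} n 1).RightMoves := by
  refine ⟨fun j => ?_⟩
  induction n with
  | zero => exact j.elim
  | succ n ih =>
    rcases moveRight_add_cases (x := natMul n 1) (y := 1) j with ⟨i, -⟩ | ⟨i, -⟩
    · exact ih i
    · exact i.elim

theorem of_moveRight_natMul_neg_one (n : ℕ) (j : (natMul.{u} n (-1)).RightMoves) :
    Game.of ((natMul n (-1)).moveRight j) = n • (-1 : Game.{u}) + 1 := by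
  induction n with
  | zero => exact j.elim
  | succ n ih =>
    rcases moveRight_add_cases (x := natMul n (-1)) (y := -1) j with ⟨i, hi⟩ | ⟨i, hi⟩
    · refine (congrArg Game.of hi).trans ?_
      rw [Game.of_add, ih i, succ_nsmul, Game.of_neg, Game.of_one]
      abel
    · refine (congrArg Game.of hi).trans ?_
      have h0 : (-1 : PGame.{u}).moveRight i = 0 := neg_zero_eq
      rw [Game.of_add, h0, of_natMul, succ_nsmul, Game.of_neg, Game.of_one, Game.of_zero]
      abel

/-- Every move of Right in an integer is to the next larger integer. -/
theorem of_moveRight_intMul_one (c : ℤ) (j : (intMul.{u} c 1).RightMoves) :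
    Game.of ((intMul c 1).moveRight j) = (c + 1) • (1 : Game.{u}) := by
  cases c with
  | ofNat n => exact (isEmpty_rightMoves_natMul_one n).elim j
  | negSucc n =>
    refine (of_moveRight_natMul_neg_one (n + 1) j).trans ?_
    rw [Int.negSucc_eq, ← natCast_zsmul, Nat.cast_succ, smul_neg, add_smul (-((n : ℤ) + 1)),
      neg_smul, one_smul]

theorem ofReal_intCast_le (c : ℤ) : Game.ofReal.{u} c ≤ c • (1 : Game.{u}) := by
  rw [← Game.of_one, ← of_intMul]
  refine le_iff.2 ⟨fun q hq => ?_, fun j hj => ?_⟩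
  · have h := of_dyadic_lt.{u} q.down.2
    rw [← Game.of_one, ← of_intMul] at h
    exact not_le_of_gt h (Game.of_le_of.2 hq)
  · have hlt : (c : ℝ) < ((c + 1 : ℤ) : ℝ) / 2 ^ 0 := by simp
    refine not_le_of_moveRight_le (x := ofReal c) (y := (intMul c 1).moveRight j)
      ⟨(c + 1, 0), hlt⟩ (Game.of_le_of.1 ?_) hj
    rw [of_moveRight_intMul_one]
    exact (of_dyadic (c + 1, 0)).le

theorem neg_ofReal_le (r : ℝ) : -Game.ofReal.{u} r ≤ Game.ofReal (-r) := by
  have hneg : ∀ q : ℤ × ℕ, Game.of (-dyadic.{u} q) = Game.of (dyadic (-q.1, q.2)) := fun q => by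
    rw [Game.of_neg, of_dyadic, of_dyadic, neg_smul]
  refine le_of_options (x := -ofReal r) (y := ofReal (-r)) (fun q => ?_) (fun q => ?_)
  · obtain ⟨q, hq⟩ := q
    exact ⟨⟨(-q.1, q.2), by push_cast; rw [neg_div]; exact neg_lt_neg hq⟩,
      Game.of_le_of.1 (hneg q).le⟩
  · obtain ⟨q, hq⟩ := q
    refine ⟨⟨(-q.1, q.2), by push_cast; rw [neg_div]; linarith⟩, Game.of_le_of.1 ?_⟩
    refine (hneg (-q.1, q.2)).le.trans ?_
    rw [neg_neg]; exact le_rfl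

theorem ofReal_intCast (c : ℤ) : Game.ofReal.{u} c = c • (1 : Game.{u}) := by
  refine le_antisymm (ofReal_intCast_le c) ?_
  have h := (neg_ofReal_le (c : ℝ)).trans
    (by simpa using ofReal_intCast_le.{u} (-c))
  exact neg_le_neg_iff.1 h

theorem ofReal_mono : Monotone Game.ofReal.{u} := fun r s hrs =>
  le_iff.2 ⟨fun q => not_le_of_le_moveLeft (y := ofReal s)
      ⟨q.down.1, q.down.2.trans_le hrs⟩ (PGame.le_refl _),
    fun q => not_le_of_moveRight_le (x := ofReal r)
      ⟨q.down.1, hrs.trans_lt q.down.2⟩ (PGame.le_refl _)⟩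

end PGame

theorem HasRatMean.hasMeanValue {g : Game.{u}} {q : ℚ} (h : HasRatMean g q) :
    g.HasMeanValue q := by
  obtain ⟨m, hm⟩ := h
  refine ⟨m + 1, fun n => ⟨?_, ?_⟩⟩
  · have h₁ := Int.lt_floor_add_one (n * q - m)
    have h₂ : ((n * q - m : ℚ) : ℝ) < ((⌊n * q - m⌋ : ℚ) + 1 : ℚ) := by exact_mod_cast h₁
    refine (PGame.ofReal_mono ?_).trans ((PGame.ofReal_intCast ⌊n * q - m⌋).le.trans
      ((hm n _).1 (Int.floor_le _)))
    push_cast at *; linarith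
  · have h₁ := Int.ceil_lt_add_one (n * q + m)
    have h₂ : ((⌈n * q + m⌉ : ℚ) : ℝ) < ((n * q + m : ℚ) + 1 : ℚ) := by exact_mod_cast h₁
    refine ((hm n _).2 (Int.le_ceil _)).trans ((PGame.ofReal_intCast ⌈n * q + m⌉).ge.trans
      (PGame.ofReal_mono ?_))
    push_cast at *; linarith

/-! ### A theorem of the alternative over the rational numbers -/

/-- Ville's theorem of the alternative, restricted to a finite set `s` of columns, over `ℚ`. The
proof eliminates one column at a time, as in the method of Fourier and Motzkin: after the
elimination the rows are the old rows with a nonnegative entry in that column, and one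
combination for each pair of entries of opposite signs. -/
theorem exists_neg_or_exists_nonneg_finset {B : Type w} (s : Finset B) :
    ∀ {A : Type v} [Fintype A] (M : A → B → ℚ),
      (∃ k : B → ℚ, (∀ b, 0 ≤ k b) ∧ ∀ a, ∑ b ∈ s, k b * M a b < 0) ∨
        ∃ p : A → ℚ, (∀ a, 0 ≤ p a) ∧ p ≠ 0 ∧ ∀ b ∈ s, 0 ≤ ∑ a, p a * M a b := by
  classical
  induction s using Finset.induction_on with
  | empty =>
    intro A _ M
    rcases isEmpty_or_nonempty A with hA | ⟨⟨a⟩⟩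
    · exact Or.inl ⟨0, fun _ => le_rfl, fun a => hA.elim a⟩
    · exact Or.inr ⟨1, fun _ => zero_le_one, fun h => one_ne_zero (congrFun h a), by simp⟩
  | insert b₀ s hb₀ ih =>
    intro A _ M
    let m : A → ℚ := fun a => M a b₀
    -- The rows after elimination, as combinations of the given rows.
    let R := {a // 0 ≤ m a} ⊕ ({a // 0 < m a} × {a // m a < 0})
    let W : R → A → ℚ := fun r => r.elim (fun a => Pi.single a.1 1)
      fun q => Pi.single q.1.1 (-m q.2.1) + Pi.single q.2.1 (m q.1.1)
    have hWinl : ∀ (a : {a // 0 ≤ m a}) (f : A → ℚ), ∑ x, W (Sum.inl a) x * f x = f a.1 := by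
      intro a f
      simp [W, Pi.single_apply]
    have hWinr : ∀ (q : {a // 0 < m a} × {a // m a < 0}) (f : A → ℚ),
        ∑ x, W (Sum.inr q) x * f x = -m q.2.1 * f q.1.1 + m q.1.1 * f q.2.1 := by
      intro q f
      simp [W, Pi.single_apply, add_mul, Finset.sum_add_distrib]
    have hW0 : ∀ r a, 0 ≤ W r a := by
      rintro (a | q) x
      · exact (Pi.single_nonneg.2 zero_le_one : (0 : A → ℚ) ≤ Pi.single a.1 1) x
      · exact add_nonneg
          ((Pi.single_nonneg.2 (neg_pos.2 q.2.2).le : (0 : A → ℚ) ≤ Pi.single q.1.1 _) x)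
          ((Pi.single_nonneg.2 q.1.2.le : (0 : A → ℚ) ≤ Pi.single q.2.1 _) x)
    have hWm : ∀ r, 0 ≤ ∑ a, W r a * m a := by
      rintro (a | q)
      · rw [hWinl]; exact a.2
      · rw [hWinr]; exact le_of_eq (by ring)
    have hWpos : ∀ r, 0 < ∑ a, W r a := by
      rintro (a | q)
      · have := hWinl a 1
        simp only [Pi.one_apply, mul_one] at this
        rw [this]; exact one_pos
      · have := hWinr q 1
        simp only [Pi.one_apply, mul_one] at this
        rw [this]; have := q.1.2; have := q.2.2; linarith
    rcases ih (fun r b => ∑ a, W r a * M a b) with ⟨k, hk, hneg⟩ | ⟨p, hp, hp0, hpos⟩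
    · left
      let r : A → ℚ := fun a => ∑ b ∈ s, k b * M a b
      have hr : ∀ q, ∑ a, W q a * r a < 0 := fun q => by
        refine lt_of_eq_of_lt ?_ (hneg q)
        simp only [r, Finset.mul_sum]
        rw [Finset.sum_comm]
        exact Finset.sum_congr rfl fun b _ => Finset.sum_congr rfl fun a _ => by ring
      -- The coefficient `t` of the eliminated column lies between the bounds from its negative
      -- entries and those from its positive entries.
      obtain ⟨t, ht₁, ht₂⟩ := Order.exists_between_finsets
        (insert 0 ((Finset.univ.filter fun a => m a < 0).image fun a => r a / -m a))
        ((Finset.univ.filter fun a => 0 < m a).image fun a => -r a / m a) (by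
          intro x hx y hy
          obtain ⟨a, ha, rfl⟩ := Finset.mem_image.1 hy
          have ha' : 0 < m a := (Finset.mem_filter.1 ha).2
          rcases Finset.mem_insert.1 hx with rfl | hx
          · have := hr (Sum.inl ⟨a, ha'.le⟩)
            rw [hWinl] at this
            exact div_pos (neg_pos.2 this) ha'
          · obtain ⟨a', ha₁, rfl⟩ := Finset.mem_image.1 hx
            have ha₁' : m a' < 0 := (Finset.mem_filter.1 ha₁).2
            have := hr (Sum.inr ⟨⟨a, ha'⟩, ⟨a', ha₁'⟩⟩)
            rw [hWinr] at this
            rw [div_lt_div_iff₀ (neg_pos.2 ha₁') ha']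
            simp only at this
            linarith)
      refine ⟨Function.update k b₀ t, fun b => ?_, fun a => ?_⟩
      · by_cases hb : b = b₀
        · subst hb
          simpa using (ht₁ 0 (Finset.mem_insert_self _ _)).le
        · simpa [hb] using hk b
      · have hsum : ∑ b ∈ s, Function.update k b₀ t b * M a b = r a :=
          Finset.sum_congr rfl fun b hb => by
            rw [Function.update_of_ne (ne_of_mem_of_not_mem hb hb₀)]
        rw [Finset.sum_insert hb₀, hsum, Function.update_self]
        change t * m a + r a < 0
        rcases lt_trichotomy (m a) 0 with h | h | h
        · have := ht₁ (r a / -m a) (Finset.mem_insert_of_mem (Finset.mem_image.2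
            ⟨a, Finset.mem_filter.2 ⟨Finset.mem_univ _, h⟩, rfl⟩))
          rw [div_lt_iff₀ (neg_pos.2 h)] at this
          linarith
        · have := hr (Sum.inl ⟨a, h.ge⟩)
          rw [hWinl] at this
          rw [h, mul_zero, zero_add]; exact this
        · have := ht₂ (-r a / m a) (Finset.mem_image.2
            ⟨a, Finset.mem_filter.2 ⟨Finset.mem_univ _, h⟩, rfl⟩)
          rw [lt_div_iff₀ h] at this
          linarith
    · right
      have hcomm : ∀ f : A → ℚ, ∑ a, (∑ r, p r * W r a) * f a = ∑ r, p r * ∑ a, W r a * f a := by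
        intro f
        simp only [Finset.sum_mul, Finset.mul_sum]
        rw [Finset.sum_comm]
        exact Finset.sum_congr rfl fun b _ => Finset.sum_congr rfl fun a _ => by ring
      refine ⟨fun a => ∑ r, p r * W r a,
        fun a => Finset.sum_nonneg fun r _ => mul_nonneg (hp r) (hW0 r a), fun h0 => ?_,
        fun b hb => ?_⟩
      · obtain ⟨r₀, hr₀⟩ := Function.ne_iff.1 hp0
        have h₁ := hcomm 1
        simp only [Pi.one_apply, mul_one] at h₁
        have h₂ : 0 < ∑ r, p r * ∑ a, W r a :=
          Finset.sum_pos' (fun r _ => mul_nonneg (hp r) (hWpos r).le)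
            ⟨r₀, Finset.mem_univ _, mul_pos (lt_of_le_of_ne (hp r₀) (Ne.symm hr₀)) (hWpos r₀)⟩
        rw [← h₁] at h₂
        refine h₂.ne' (Finset.sum_eq_zero fun a _ => congrFun h0 a)
      · rw [hcomm]
        rcases Finset.mem_insert.1 hb with rfl | hb
        · exact Finset.sum_nonneg fun r _ => mul_nonneg (hp r) (hWm r)
        · exact hpos b hb

theorem exists_nat_multiples {B : Type*} [Fintype B] (k : B → ℚ) (hk : ∀ b, 0 ≤ k b) :
    ∃ (D : ℕ) (k' : B → ℕ), 0 < D ∧ ∀ b, (k' b : ℚ) = D * k b := by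
  have h : ∀ b, ∃ c : ℕ, (c : ℚ) = (∏ b, (k b).den : ℕ) * k b := fun b => by
    obtain ⟨e, he⟩ := Finset.dvd_prod_of_mem (fun b => (k b).den) (Finset.mem_univ b)
    refine ⟨e * (k b).num.toNat, ?_⟩
    have h₁ : (((k b).num.toNat : ℤ) : ℚ) = (k b).num := by
      rw [Int.toNat_of_nonneg (Rat.num_nonneg.2 (hk b))]
    rw [he]
    push_cast at h₁ ⊢
    rw [h₁, mul_comm ((k b).den : ℚ), mul_assoc, Rat.den_mul_eq_num]
  choose k' hk' using h
  exact ⟨_, k', Finset.prod_pos fun b _ => (k b).den_pos, hk'⟩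

/-- Ville's theorem of the alternative for rational matrices, with integral solutions. -/
theorem exists_neg_or_exists_nonneg {A : Type v} {B : Type w} [Fintype A] [Fintype B]
    (M : A → B → ℚ) :
    (∃ k : B → ℕ, ∀ a, ∑ b, (k b : ℚ) * M a b < 0) ∨
      ∃ p : A → ℕ, p ≠ 0 ∧ ∀ b, 0 ≤ ∑ a, (p a : ℚ) * M a b := by
  rcases exists_neg_or_exists_nonneg_finset Finset.univ M with ⟨k, hk, h⟩ | ⟨p, hp, hp0, h⟩
  · obtain ⟨D, k', hD, hk'⟩ := exists_nat_multiples k hk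
    refine Or.inl ⟨k', fun a => ?_⟩
    simp only [hk', mul_assoc]
    rw [← Finset.mul_sum]
    exact mul_neg_of_pos_of_neg (by exact_mod_cast hD) (h a)
  · obtain ⟨D, p', hD, hp'⟩ := exists_nat_multiples p hp
    refine Or.inr ⟨p', fun h0 => hp0 (funext fun a => ?_), fun b => ?_⟩
    · have h₁ := hp' a
      rw [h0] at h₁
      have hD' : (D : ℚ) ≠ 0 := by exact_mod_cast hD.ne'
      simpa [hD'] using h₁
    · simp only [hp', mul_assoc]
      rw [← Finset.mul_sum]
      exact mul_nonneg D.cast_nonneg (h b (Finset.mem_univ b))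

/-! ### Books and mixed outcomes -/

theorem isRepeatedMix_of_ne_zero {A : Type v} [Fintype A] {c : A → ℕ} (hc : c ≠ 0) :
    IsRepeatedMix (fun a => (c a : ℚ) / (∑ a, c a : ℕ)) (∑ a, c a) c := by
  have hpos : 0 < ∑ a, c a := by
    obtain ⟨a, ha⟩ := Function.ne_iff.1 hc
    exact Finset.sum_pos' (fun _ _ => Nat.zero_le _) ⟨a, Finset.mem_univ _, Nat.pos_of_ne_zero ha⟩
  have hpos' : ((∑ a, c a : ℕ) : ℚ) ≠ 0 := by exact_mod_cast hpos.ne'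
  refine ⟨⟨fun a => by positivity, ?_⟩, hpos, fun a => by field_simp⟩
  rw [← Finset.sum_div, ← Nat.cast_sum, div_self hpos']

theorem exists_forall_ge_of_finite {ι : Type*} [Finite ι] {P : ι → ℕ → Prop}
    (h : ∀ i, ∃ N, ∀ n ≥ N, P i n) : ∃ n, ∀ i, P i n := by
  have : ∀ᶠ n in Filter.atTop, ∀ i, P i n :=
    Filter.eventually_all.2 fun i => Filter.eventually_atTop.2 (h i)
  exact this.exists

section

variable {A : Type v} {B : Type w} {G : A → B → PGame.{u}} {M : A → B → ℚ}

theorem bookGame_smul [Fintype B] (n : ℕ) (k : B → ℕ) (a : A) :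
    bookGame G (fun b => n * k b) a = n • bookGame G k a := by
  simp only [bookGame, Finset.smul_sum, mul_smul]

theorem aliceGame_smul [Fintype A] (n : ℕ) (c : A → ℕ) (b : B) :
    aliceGame G (fun a => n * c a) b = n • aliceGame G c b := by
  simp only [aliceGame, Finset.smul_sum, mul_smul]

theorem hasRatMean_bookGame [Fintype B] (hM : ∀ a b, HasRatMean (Game.of (G a b)) (M a b))
    (k : B → ℕ) (a : A) : HasRatMean (bookGame G k a) (∑ b, (k b : ℚ) * M a b) :=
  HasRatMean.sum _ fun b => (hM a b).nsmul (k b)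

theorem hasRatMean_aliceGame [Fintype A] (hM : ∀ a b, HasRatMean (Game.of (G a b)) (M a b))
    (c : A → ℕ) (b : B) : HasRatMean (aliceGame G c b) (∑ a, (c a : ℚ) * M a b) :=
  HasRatMean.sum _ fun a => (hM a b).nsmul (c a)

/-- If the weighted sums of the columns are `≤ 0` and those of the rows are `≥ 0`, then each of
them has weight zero or vanishes: both kinds of sums have the same weighted total. -/
theorem complementary_slackness [Fintype A] [Fintype B] {k : B → ℕ} {c : A → ℕ}
    (hk : ∀ a, ∑ b, (k b : ℚ) * M a b ≤ 0) (hc : ∀ b, 0 ≤ ∑ a, (c a : ℚ) * M a b) :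
    (∀ a, 0 < c a → ∑ b, (k b : ℚ) * M a b = 0) ∧
      ∀ b, 0 < k b → ∑ a, (c a : ℚ) * M a b = 0 := by
  have hcomm : ∑ a, (c a : ℚ) * ∑ b, (k b : ℚ) * M a b =
      ∑ b, (k b : ℚ) * ∑ a, (c a : ℚ) * M a b := by
    simp only [Finset.mul_sum]
    rw [Finset.sum_comm]
    exact Finset.sum_congr rfl fun b _ => Finset.sum_congr rfl fun a _ => by ring
  have h₁ : ∀ a ∈ Finset.univ, (c a : ℚ) * ∑ b, (k b : ℚ) * M a b ≤ 0 := fun a _ =>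
    mul_nonpos_of_nonneg_of_nonpos (c a).cast_nonneg (hk a)
  have h₂ : ∀ b ∈ Finset.univ, 0 ≤ (k b : ℚ) * ∑ a, (c a : ℚ) * M a b := fun b _ =>
    mul_nonneg (k b).cast_nonneg (hc b)
  have h₃ := (Finset.sum_nonneg h₂)
  have h₄ := (Finset.sum_nonpos h₁)
  constructor
  · intro a ha
    have h := (Finset.sum_eq_zero_iff_of_nonpos h₁).1 (le_antisymm h₄ (hcomm ▸ h₃)) a
      (Finset.mem_univ a)
    exact (mul_eq_zero.1 h).resolve_left (by exact_mod_cast ha.ne')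
  · intro b hb
    have h := (Finset.sum_eq_zero_iff_of_nonneg h₂).1 (le_antisymm (hcomm ▸ h₄) h₃) b
      (Finset.mem_univ b)
    exact (mul_eq_zero.1 h).resolve_left (by exact_mod_cast hb.ne')

end

end Comb

theorem theorem3 {A : Type v} {B : Type w} [Fintype A] [Fintype B]
    (G : A → B → Comb.PGame.{u}) (hshort : ∀ a b, (G a b).Short)
    (hcoh : Comb.Coherent G) :
    (∃ (p : A → ℚ) (n : ℕ) (c : A → ℕ), Comb.IsRepeatedMix p n c ∧
      ∀ b, 0 < Comb.aliceGame G c b) ∨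
    (∃ (k : B → ℕ) (p : A → ℚ) (n : ℕ) (c : A → ℕ), k ≠ 0 ∧ Comb.IsRepeatedMix p n c ∧
      (∀ a, ∃ μ : ℝ, (Comb.bookGame G k a).HasMeanValue μ ∧ μ ≤ 0 ∧ (0 < p a → μ = 0)) ∧
      (∀ b, ∃ μ : ℝ, (Comb.aliceGame G c b).HasMeanValue μ ∧ 0 ≤ μ ∧ (0 < k b → μ = 0))) := by
  choose M hM using fun a b => (hshort a b).exists_hasRatMean
  -- A book with negative mean values becomes a Dutch book when repeated often enough.
  obtain ⟨c, hc0, hc⟩ := (Comb.exists_neg_or_exists_nonneg M).resolve_left <| by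
    rintro ⟨k, hk⟩
    obtain ⟨n, hn⟩ := Comb.exists_forall_ge_of_finite fun a =>
      (Comb.hasRatMean_bookGame hM k a).exists_nsmul_neg (hk a)
    exact hcoh ⟨fun b => n * k b, fun a => by rw [Comb.bookGame_smul]; exact hn a⟩
  rcases Comb.exists_neg_or_exists_nonneg (fun b a => -M a b) with ⟨c', hc'⟩ | ⟨k, hk0, hk⟩
  · left
    rcases isEmpty_or_nonempty B with hB | ⟨⟨b₀⟩⟩
    · exact ⟨_, _, c, Comb.isRepeatedMix_of_ne_zero hc0, fun b => hB.elim b⟩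
    have hpos : ∀ b, 0 < ∑ a, (c' a : ℚ) * M a b := fun b => by
      have := hc' b
      simp only [mul_neg, Finset.sum_neg_distrib] at this
      linarith
    obtain ⟨n, hn⟩ := Comb.exists_forall_ge_of_finite fun b =>
      (Comb.hasRatMean_aliceGame hM c' b).exists_nsmul_pos (hpos b)
    simp only [← Comb.aliceGame_smul] at hn
    refine ⟨_, _, fun a => n * c' a, Comb.isRepeatedMix_of_ne_zero fun h0 => ?_, hn⟩
    have h := hn b₀
    rw [h0] at h
    simp [Comb.aliceGame] at h
  · right
    have hk' : ∀ a, ∑ b, (k b : ℚ) * M a b ≤ 0 := fun a => by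
      have := hk a
      simp only [mul_neg, Finset.sum_neg_distrib] at this
      linarith
    obtain ⟨h₁, h₂⟩ := Comb.complementary_slackness hk' hc
    refine ⟨k, _, _, c, hk0, Comb.isRepeatedMix_of_ne_zero hc0, fun a => ?_, fun b => ?_⟩
    · refine ⟨_, (Comb.hasRatMean_bookGame hM k a).hasMeanValue, by exact_mod_cast hk' a,
        fun hp => ?_⟩
      have hca : 0 < c a := by
        by_contra h
        have : c a = 0 := by omega
        simp [this] at hp
      exact_mod_cast h₁ a hca
    · exact ⟨_, (Comb.hasRatMean_aliceGame hM c b).hasMeanValue, by exact_mod_cast hc b,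
        fun hb => by exact_mod_cast h₂ b hb⟩
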